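/- All $C^*$-algebras are complex and not necessarily unital; $\overline{\rm span}$ denotes closed linear span. Let $A$ and $B$ be $C^*$-algebras. A *right-Hilbert $A$–$B$ bimodule* is a complex vector space $X$ that is a right $B$-module with a positive definite $B$-valued sesquilinear form $\langle\cdot,\cdot\rangle_B$ (conjugate-linear in the first variable) satisfying $\langle x,y\cdot b\rangle_B=\langle x,y\rangle_B\,b$ and $\langle x,y\rangle_B^*=\langle y,x\rangle_B$, complete in the norm $\|x\|=\|\langle x,x\rangle_B\|^{1/2}$ and full ($\overline{\rm span}\,\langle X,X\rangle_B=B$), together with a left $A$-module structure that is nondegenerate ($\overline{\rm span}\,A\cdot X=X$) and satisfies $a\cdot(x\cdot b)=(a\cdot x)\cdot b$ and $\langle a\cdot x,y\rangle_B=\langle x,a^*\cdot y\rangle_B$ (all module actions being $\mathbb C$-bilinear). An isomorphism of such bimodules is a linear bijection preserving both actions and the inner product. Let $\mathcal C$ be the category whose objects are the $C^*$-algebras, whose morphisms $A\to B$ are the isomorphism classes $[X]$ of right-Hilbert $A$–$B$ bimodules, in which the composite of $[X]\colon A\to B$ with $[Y]\colon B\to C$ is the class of the internal tensor product $X\otimes_B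 Y$ (the completion of the algebraic tensor product, modulo vectors of length $0$, for $\langle x\otimes y,z\otimes w\rangle_C=\langle y,\langle x,z\rangle_B\cdot w\rangle_C$, with $a\cdot(x\otimes y)=(a\cdot x)\otimes y$ and $(x\otimes y)\cdot c=x\otimes (y\cdot c)$), and in which the identity of $A$ is the class of ${}_AA_A$ with $\langle a,b\rangle_A=a^*b$. **Proposition.** Let $X$ be a right-Hilbert $A$–$B$ bimodule. Then $[X]$ is an isomorphism in $\mathcal C$ if and only if $X$ is an $A$–$B$ imprimitivity bimodule, that is, if and only if there is an $A$-valued positive definite sesquilinear form ${}_A\langle\cdot,\cdot\rangle$ on $X$ (linear in the first variable) with ${}_A\langle a\cdot x,y\rangle=a\,{}_A\langle x,y\rangle$ and ${}_A\langle x,y\rangle^*={}_A\langle y,x\rangle$, for which $X$ is complete in the norm $\|{}_A\langle x,x\rangle\|^{1/2}$ and full ($\overline{\rm span}\,{}_A\langle X,X\rangle=A$), and such that $${}_A\langle x,y\rangle\cdot z=x\cdot\langle y,z\rangle_B\quad\text{and}\quad {}_A\langle x\cdot b,y\rangle={}_A\langle x,y\cdot b^*\rangle$$ for all $x,y,z\in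 X$ and $b\in B$. -/

import Mathlib

universe u

open scoped TensorProduct

namespace CStarMorita

/-! ### Positive elements of a C⋆-algebra -/

section Positive

/-- Positivity in a (possibly non-unital) C⋆-algebra. -/
def IsPos {B : Type*} [NonUnitalCStarAlgebra B] (b : B) : Prop := ∃ c : B, b = star c * c

variable {B : Type*} [NonUnitalCStarAlgebra B]

theorem isPos_iff_nonneg [PartialOrder B] [StarOrderedRing B] {b : B} : IsPos b ↔ 0 ≤ b := by
  constructor
  · rintro ⟨c, rfl⟩
    exact star_mul_self_nonneg c
  · intro h
    refine ⟨CFC.sqrt b, ?_⟩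
    rw [(IsSelfAdjoint.of_nonneg (CFC.sqrt_nonneg b)).star_eq, CFC.sqrt_mul_sqrt_self b h]

theorem isPos_zero : IsPos (0 : B) := ⟨0, by simp⟩

theorem IsPos.sum {ι : Type*} (s : Finset ι) {f : ι → B} (h : ∀ i ∈ s, IsPos (f i)) :
    IsPos (∑ i ∈ s, f i) := by
  let _ : PartialOrder B := CStarAlgebra.spectralOrder B
  have : StarOrderedRing B := CStarAlgebra.spectralOrderedRing B
  rw [isPos_iff_nonneg]
  exact Finset.sum_nonneg fun i hi => isPos_iff_nonneg.1 (h i hi)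

theorem isClosed_isPos : IsClosed {b : B | IsPos b} := by
  let _ : PartialOrder B := CStarAlgebra.spectralOrder B
  have : StarOrderedRing B := CStarAlgebra.spectralOrderedRing B
  simp_rw [isPos_iff_nonneg]
  exact CStarAlgebra.isClosed_nonneg

theorem IsPos.norm_le_of_sub {a b : B} (ha : IsPos a) (h : IsPos (b - a)) : ‖a‖ ≤ ‖b‖ := by
  let _ : PartialOrder B := CStarAlgebra.spectralOrder B
  have : StarOrderedRing B := CStarAlgebra.spectralOrderedRing B
  rw [isPos_iff_nonneg] at ha h
  exact CStarAlgebra.norm_le_norm_of_nonneg_of_le ha (sub_nonneg.1 h)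

end Positive

/-! ### Right-pre-Hilbert bimodules -/

/-- A complex vector space which is an `A`-`B` bimodule, with a `B`-valued positive semi-definite
sesquilinear form (conjugate-linear in the first variable) that is compatible with the actions.
Neither definiteness nor completeness is required here. -/
structure PreHilbertBimodule (A B : Type u) [NonUnitalCStarAlgebra A]
    [NonUnitalCStarAlgebra B] : Type (u + 1) where
  /-- The underlying vector space. -/
  carrier : Type u
  [addCommGroup : AddCommGroup carrier]
  [module : Module ℂ carrier]
  /-- The left action, `lact a x = a · x`. -/
  lact : A →ₗ[ℂ] carrier →ₗ[ℂ] carrier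
  /-- The right action, `ract x b = x · b`. -/
  ract : carrier →ₗ[ℂ] B →ₗ[ℂ] carrier
  /-- The `B`-valued form `⟪x, y⟫_B`. -/
  inner : carrier →ₗ⋆[ℂ] carrier →ₗ[ℂ] B
  lact_mul : ∀ a a' x, lact (a * a') x = lact a (lact a' x)
  ract_mul : ∀ x b b', ract x (b * b') = ract (ract x b) b'
  lact_ract : ∀ a x b, lact a (ract x b) = ract (lact a x) b
  inner_ract : ∀ x y b, inner x (ract y b) = inner x y * b
  star_inner : ∀ x y, star (inner x y) = inner y x
  inner_lact : ∀ a x y, inner (lact a x) y = inner x (lact (star a) y)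
  inner_self_pos : ∀ x, IsPos (inner x x)

namespace PreHilbertBimodule

variable {A B : Type u} [NonUnitalCStarAlgebra A] [NonUnitalCStarAlgebra B]

instance : CoeSort (PreHilbertBimodule A B) (Type u) := ⟨carrier⟩

instance (P : PreHilbertBimodule A B) : AddCommGroup P := P.addCommGroup
instance (P : PreHilbertBimodule A B) : Module ℂ P := P.module

variable (P : PreHilbertBimodule A B)

theorem inner_ract_left (x y : P) (b : B) : P.inner (P.ract x b) y = star b * P.inner x y := by
  rw [← P.star_inner, P.inner_ract, star_mul, P.star_inner]

theorem sq_norm_inner_le (x y : P) :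
    ‖P.inner x y‖ ^ 2 ≤ ‖P.inner x x‖ * ‖P.inner y y‖ := by
  let _ : PartialOrder B := CStarAlgebra.spectralOrder B
  have : StarOrderedRing B := CStarAlgebra.spectralOrderedRing B
  set a := P.inner x y with ha
  set N := ‖P.inner x x‖ with hN
  have hN0 : 0 ≤ N := norm_nonneg _
  have key : ∀ t : ℝ, N < t → ‖a‖ ^ 2 ≤ t * ‖P.inner y y‖ := by
    intro t ht
    have ht0 : 0 < t := lt_of_le_of_lt hN0 ht
    have h1 : 0 ≤ P.inner (P.ract x a - (t : ℂ) • y) (P.ract x a - (t : ℂ) • y) :=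
      isPos_iff_nonneg.1 (P.inner_self_pos _)
    have h2 : P.inner (P.ract x a - (t : ℂ) • y) (P.ract x a - (t : ℂ) • y)
        = star a * P.inner x x * a - (2 * t) • (star a * a) + (t ^ 2) • P.inner y y := by
      have hyx : P.inner y x = star a := by rw [ha, P.star_inner]
      simp only [map_sub, LinearMap.sub_apply, map_smulₛₗ, LinearMap.smul_apply, P.inner_ract,
        P.inner_ract_left, hyx, ← ha, RingHom.id_apply, Complex.conj_ofReal]
      simp only [Complex.coe_smul, two_mul, add_smul, sq, mul_smul, smul_sub]
      abel
    have h3 : star a * P.inner x x * a ≤ N • (star a * a) := by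
      refine CStarAlgebra.star_left_conjugate_le_norm_smul (hb := ?_)
      exact IsSelfAdjoint.of_nonneg (isPos_iff_nonneg.1 (P.inner_self_pos x))
    have h4 : 0 ≤ N • (star a * a) - (2 * t) • (star a * a) + (t ^ 2) • P.inner y y := by
      rw [h2] at h1
      refine h1.trans ?_
      gcongr
    have h5 : t • (star a * a) ≤ (t ^ 2) • P.inner y y := by
      have h6 : 0 ≤ (t - N) • (star a * a) :=
        smul_nonneg (by linarith) (star_mul_self_nonneg a)
      have h7 := add_nonneg h4 h6
      rw [← sub_nonneg]
      convert h7 using 1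
      module
    have h8 : star a * a ≤ t • P.inner y y := by
      rw [sq, mul_smul] at h5
      exact (smul_le_smul_iff_of_pos_left ht0).1 h5
    have h9 := CStarAlgebra.norm_le_norm_of_nonneg_of_le (star_mul_self_nonneg a) h8
    rw [CStarRing.norm_star_mul_self, norm_smul, Real.norm_of_nonneg ht0.le] at h9
    rw [sq]; exact h9
  refine ge_of_tendsto (x := nhdsWithin N (Set.Ioi N)) (f := fun t => t * ‖P.inner y y‖) ?_ ?_
  · exact ((continuous_id.mul continuous_const).tendsto N).mono_left nhdsWithin_le_nhds
  · filter_upwards [self_mem_nhdsWithin] with t ht using key t ht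

/-- The seminorm `‖x‖ = ‖⟪x, x⟫_B‖ ^ (1/2)`. -/
noncomputable instance : Norm P := ⟨fun x => √‖P.inner x x‖⟩

theorem norm_def (x : P) : ‖x‖ = √‖P.inner x x‖ := rfl

theorem sq_norm (x : P) : ‖x‖ ^ 2 = ‖P.inner x x‖ := Real.sq_sqrt (norm_nonneg _)

theorem norm_inner_le' (x y : P) : ‖P.inner x y‖ ≤ ‖x‖ * ‖y‖ := by
  rw [norm_def, norm_def, ← Real.sqrt_mul (norm_nonneg _)]
  exact Real.le_sqrt_of_sq_le (P.sq_norm_inner_le x y)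

theorem normCore : SeminormedSpace.Core ℂ P where
  norm_nonneg x := Real.sqrt_nonneg _
  norm_smul c x := by
    simp only [norm_def, map_smulₛₗ, LinearMap.smul_apply, norm_smul, RingHom.id_apply,
      RCLike.norm_conj]
    rw [← mul_assoc, Real.sqrt_mul (by positivity), Real.sqrt_mul_self (norm_nonneg _)]
  norm_triangle x y := by
    have h0 : ∀ z : P, 0 ≤ ‖z‖ := fun z => Real.sqrt_nonneg _
    refine (sq_le_sq₀ (h0 _) (add_nonneg (h0 x) (h0 y))).1 ?_
    rw [sq_norm]
    simp only [map_add, LinearMap.add_apply]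
    have h1 := P.norm_inner_le' x y
    have h2 := P.norm_inner_le' y x
    have h3 := P.sq_norm x
    have h4 := P.sq_norm y
    calc _ ≤ ‖P.inner x x‖ + ‖P.inner y x‖ + (‖P.inner x y‖ + ‖P.inner y y‖) :=
          (norm_add_le _ _).trans (add_le_add (norm_add_le _ _) (norm_add_le _ _))
      _ ≤ _ := by nlinarith

noncomputable instance : SeminormedAddCommGroup P := SeminormedAddCommGroup.ofCore P.normCore

noncomputable instance : NormedSpace ℂ P where
  norm_smul_le c x := (P.normCore.norm_smul c x).le

theorem norm_ract_le (x : P) (b : B) : ‖P.ract x b‖ ≤ ‖x‖ * ‖b‖ := by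
  refine (sq_le_sq₀ (norm_nonneg _) (by positivity)).1 ?_
  rw [sq_norm, mul_pow, sq_norm, P.inner_ract, P.inner_ract_left]
  calc _ ≤ ‖star b‖ * ‖P.inner x x‖ * ‖b‖ :=
        (norm_mul_le _ _).trans (by gcongr; exact norm_mul_le _ _)
    _ = _ := by rw [norm_star]; ring

theorem norm_lact_le (a : A) (x : P) : ‖P.lact a x‖ ≤ ‖a‖ * ‖x‖ := by
  refine (sq_le_sq₀ (norm_nonneg _) (by positivity)).1 ?_
  rw [sq_norm, mul_pow, sq_norm]
  obtain ⟨c, hc⟩ : ∃ c : Unitization ℂ A,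
      Unitization.inl ((‖a‖ ^ 2 : ℝ) : ℂ) - star (a : Unitization ℂ A) * (a : Unitization ℂ A) = star c * c := by
    let _ : PartialOrder (Unitization ℂ A) := CStarAlgebra.spectralOrder _
    have : StarOrderedRing (Unitization ℂ A) := CStarAlgebra.spectralOrderedRing _
    refine isPos_iff_nonneg.2 (sub_nonneg.2 ?_)
    have := CStarAlgebra.star_mul_le_algebraMap_norm_sq (a := (a : Unitization ℂ A))
    rwa [Unitization.norm_inr, IsScalarTower.algebraMap_apply ℝ ℂ (Unitization ℂ A),
      Unitization.algebraMap_eq_inl] at this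
  have h1 : ((‖a‖ ^ 2 : ℝ) : ℂ) = c.fst * (starRingEnd ℂ) c.fst := by
    have := congrArg (fun z : Unitization ℂ A => z.fst) hc
    rw [mul_comm]
    simpa [sub_eq_add_neg] using this
  have h2 : -(star a * a) =
      (starRingEnd ℂ) c.fst • c.snd + c.fst • star c.snd + star c.snd * c.snd := by
    have := congrArg (fun z : Unitization ℂ A => z.snd) hc
    simpa [sub_eq_add_neg] using this
  have h3 : ((‖a‖ ^ 2 : ℝ) : ℂ) • P.inner x x - P.inner (P.lact a x) (P.lact a x)
      = P.inner (c.fst • x + P.lact c.snd x) (c.fst • x + P.lact c.snd x) := by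
    have e : P.inner x (P.lact (-(star a * a)) x) = - P.inner (P.lact a x) (P.lact a x) := by
      rw [P.inner_lact, ← P.lact_mul, map_neg, LinearMap.neg_apply, map_neg]
    rw [sub_eq_add_neg, ← e, h1, h2]
    simp only [map_add, LinearMap.add_apply, map_smulₛₗ, LinearMap.smul_apply, P.inner_lact,
      RingHom.id_apply, P.lact_mul, smul_add, mul_smul]
    abel
  have h4 := (P.inner_self_pos (P.lact a x)).norm_le_of_sub (by rw [h3]; exact P.inner_self_pos _)
  refine h4.trans_eq ?_
  rw [norm_smul, Complex.norm_real, Real.norm_of_nonneg (by positivity)]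

/-! The completion. -/

section Completion

open UniformSpace

/-- The left action by one element, as a bounded operator. -/
noncomputable def lactL (a : A) : P →L[ℂ] P :=
  (P.lact a).mkContinuous ‖a‖ (P.norm_lact_le a)

/-- The right action by one element, as a bounded operator. -/
noncomputable def ractL (b : B) : P →L[ℂ] P :=
  (P.ract.flip b).mkContinuous ‖b‖ fun x => by
    rw [mul_comm]; exact P.norm_ract_le x b

/-- The form, as a bounded sesquilinear map. -/
noncomputable def innerL : P →L⋆[ℂ] P →L[ℂ] B :=
  P.inner.mkContinuous₂ 1 fun x y => by rw [one_mul]; exact P.norm_inner_le' x y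

@[simp] theorem lactL_apply (a : A) (x : P) : P.lactL a x = P.lact a x := rfl
@[simp] theorem ractL_apply (b : B) (x : P) : P.ractL b x = P.ract x b := rfl
@[simp] theorem innerL_apply (x y : P) : P.innerL x y = P.inner x y := rfl

section Extend

variable {T : Type*} [SeminormedAddCommGroup T] [NormedSpace ℂ T] {σ : ℂ →+* ℂ}
  {F : Type*} [AddCommGroup F] [UniformSpace F] [IsUniformAddGroup F] [T0Space F]
  [Module ℂ F] [ContinuousConstSMul ℂ F] [CompleteSpace F]
  {E : Type*} [NormedAddCommGroup E] [NormedSpace ℂ E] [CompleteSpace E]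

/-- Extension of a bounded (semi-)linear map to the completion. -/
noncomputable def extC (f : T →SL[σ] F) : Completion T →SL[σ] F :=
  f.extend (Completion.toComplL : T →L[ℂ] Completion T)

@[simp] theorem extC_coe (f : T →SL[σ] F) (x : T) : extC f (x : Completion T) = f x :=
  f.extend_eq (e := (Completion.toComplL : T →L[ℂ] Completion T)) Completion.denseRange_coe
    (Completion.isUniformInducing_coe T) x

/-- Extension of a bounded sesquilinear form to the completion. -/
noncomputable def extForm (f : T →L⋆[ℂ] T →L[ℂ] E) :
    Completion T →L⋆[ℂ] Completion T →L[ℂ] E :=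
  let g : Completion T →L⋆[ℂ] (T →L[ℂ] E) := extC f
  let h : T →L[ℂ] (Completion T →L⋆[ℂ] E) := g.flip
  let k : Completion T →L[ℂ] (Completion T →L⋆[ℂ] E) := extC h
  k.flip

@[simp] theorem extForm_coe (f : T →L⋆[ℂ] T →L[ℂ] E) (x y : T) :
    extForm f (x : Completion T) (y : Completion T) = f x y := by
  simp [extForm]

end Extend

/-- The left action on the completion. -/
noncomputable def lactC (a : A) : Completion P →L[ℂ] Completion P :=
  extC (Completion.toComplL ∘L P.lactL a)

/-- The right action on the completion. -/
noncomputable def ractC (b : B) : Completion P →L[ℂ] Completion P :=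
  extC (Completion.toComplL ∘L P.ractL b)

/-- The form on the completion. -/
noncomputable def innerC : Completion P →L⋆[ℂ] Completion P →L[ℂ] B := extForm P.innerL

@[simp] theorem lactC_coe (a : A) (x : P) :
    P.lactC a (x : Completion P) = ((P.lact a x : P) : Completion P) := extC_coe _ _

@[simp] theorem ractC_coe (b : B) (x : P) :
    P.ractC b (x : Completion P) = ((P.ract x b : P) : Completion P) := extC_coe _ _

@[simp] theorem innerC_coe (x y : P) :
    P.innerC (x : Completion P) (y : Completion P) = P.inner x y := extForm_coe _ _ _

theorem lactC_add (a a' : A) (x : Completion P) :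
    P.lactC (a + a') x = P.lactC a x + P.lactC a' x := by
  induction x using Completion.induction_on with
  | hp => exact isClosed_eq (by fun_prop) (by fun_prop)
  | ih x => rw [lactC_coe, lactC_coe, lactC_coe, map_add, LinearMap.add_apply, Completion.coe_add]

theorem lactC_smul (c : ℂ) (a : A) (x : Completion P) :
    P.lactC (c • a) x = c • P.lactC a x := by
  induction x using Completion.induction_on with
  | hp => exact isClosed_eq (P.lactC _).continuous ((P.lactC _).continuous.const_smul c)
  | ih x => rw [lactC_coe, lactC_coe, P.lact.map_smul, LinearMap.smul_apply, Completion.coe_smul]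

theorem ractC_add (b b' : B) (x : Completion P) :
    P.ractC (b + b') x = P.ractC b x + P.ractC b' x := by
  induction x using Completion.induction_on with
  | hp => exact isClosed_eq (by fun_prop) (by fun_prop)
  | ih x => rw [ractC_coe, ractC_coe, ractC_coe, map_add, Completion.coe_add]

theorem ractC_smul (c : ℂ) (b : B) (x : Completion P) :
    P.ractC (c • b) x = c • P.ractC b x := by
  induction x using Completion.induction_on with
  | hp => exact isClosed_eq (P.ractC _).continuous ((P.ractC _).continuous.const_smul c)
  | ih x => rw [ractC_coe, ractC_coe, (P.ract x).map_smul, Completion.coe_smul]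

theorem lactC_mul (a a' : A) (x : Completion P) :
    P.lactC (a * a') x = P.lactC a (P.lactC a' x) := by
  induction x using Completion.induction_on with
  | hp => exact isClosed_eq (by fun_prop) (by fun_prop)
  | ih x => rw [lactC_coe, lactC_coe, lactC_coe, P.lact_mul]

theorem ractC_mul (x : Completion P) (b b' : B) :
    P.ractC (b * b') x = P.ractC b' (P.ractC b x) := by
  induction x using Completion.induction_on with
  | hp => exact isClosed_eq (by fun_prop) (by fun_prop)
  | ih x => rw [ractC_coe, ractC_coe, ractC_coe, P.ract_mul]

theorem lactC_ractC (a : A) (x : Completion P) (b : B) :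
    P.lactC a (P.ractC b x) = P.ractC b (P.lactC a x) := by
  induction x using Completion.induction_on with
  | hp => exact isClosed_eq (by fun_prop) (by fun_prop)
  | ih x => rw [lactC_coe, ractC_coe, ractC_coe, lactC_coe, P.lact_ract]

theorem innerC_ractC (x y : Completion P) (b : B) :
    P.innerC x (P.ractC b y) = P.innerC x y * b := by
  induction x, y using Completion.induction_on₂ with
  | hp => exact isClosed_eq (by fun_prop) (by fun_prop)
  | ih x y => rw [ractC_coe, innerC_coe, innerC_coe, P.inner_ract]

theorem star_innerC (x y : Completion P) : star (P.innerC x y) = P.innerC y x := by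
  induction x, y using Completion.induction_on₂ with
  | hp => exact isClosed_eq (by fun_prop) (by fun_prop)
  | ih x y => rw [innerC_coe, innerC_coe, P.star_inner]

theorem innerC_lactC (a : A) (x y : Completion P) :
    P.innerC (P.lactC a x) y = P.innerC x (P.lactC (star a) y) := by
  induction x, y using Completion.induction_on₂ with
  | hp => exact isClosed_eq (by fun_prop) (by fun_prop)
  | ih x y => rw [lactC_coe, lactC_coe, innerC_coe, innerC_coe, P.inner_lact]

theorem innerC_self_pos (x : Completion P) : IsPos (P.innerC x x) := by
  induction x using Completion.induction_on with
  | hp => exact isClosed_isPos.preimage (f := fun x => P.innerC x x) (by fun_prop)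
  | ih x => rw [innerC_coe]; exact P.inner_self_pos x

/-- The completion of a right-pre-Hilbert bimodule (vectors of length zero become zero), with the
extended actions and form. -/
noncomputable def compl : PreHilbertBimodule A B where
  carrier := Completion P
  lact := LinearMap.mk₂ ℂ (fun a x => P.lactC a x) P.lactC_add P.lactC_smul
    (fun a => map_add (P.lactC a)) (fun c a => map_smul (P.lactC a) c)
  ract := LinearMap.mk₂ ℂ (fun x b => P.ractC b x)
    (fun x y b => map_add (P.ractC b) x y) (fun c x b => map_smul (P.ractC b) c x)
    (fun x b b' => P.ractC_add b b' x) (fun c x b => P.ractC_smul c b x)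
  inner := LinearMap.mk₂'ₛₗ (starRingEnd ℂ) (RingHom.id ℂ) (fun x y => P.innerC x y)
    (fun x y z => by rw [map_add]; rfl) (fun c x y => by rw [map_smulₛₗ]; rfl)
    (fun x y z => map_add _ _ _) (fun c x y => map_smul _ _ _)
  lact_mul := P.lactC_mul
  ract_mul := P.ractC_mul
  lact_ract := P.lactC_ractC
  inner_ract := P.innerC_ractC
  star_inner := P.star_innerC
  inner_lact := P.innerC_lactC
  inner_self_pos := P.innerC_self_pos

/-- The canonical map to the completion. -/
noncomputable def toCompl : P →ₗ[ℂ] P.compl :=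
  ((Completion.toComplL : P →L[ℂ] Completion P) : P →ₗ[ℂ] Completion P)

theorem lact_toCompl (a : A) (x : P) :
    P.compl.lact a (P.toCompl x) = P.toCompl (P.lact a x) := P.lactC_coe a x

theorem ract_toCompl (x : P) (b : B) :
    P.compl.ract (P.toCompl x) b = P.toCompl (P.ract x b) := P.ractC_coe b x

theorem inner_toCompl (x y : P) :
    P.compl.inner (P.toCompl x) (P.toCompl y) = P.inner x y := P.innerC_coe x y

theorem norm_toCompl (x : P) : ‖P.toCompl x‖ = ‖x‖ := by
  rw [norm_def, norm_def, inner_toCompl]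

/-- The norm of the completed space is the one defined by the extended form. -/
theorem norm_completion (x : Completion P) : ‖x‖ = √‖P.innerC x x‖ := by
  induction x using Completion.induction_on with
  | hp => exact isClosed_eq (by fun_prop) (by fun_prop)
  | ih x => rw [Completion.norm_coe, innerC_coe]; rfl

theorem denseRange_toCompl (x : P.compl) (ε : ℝ) (hε : 0 < ε) :
    ∃ y : P, ‖x - P.toCompl y‖ < ε := by
  obtain ⟨y, hy⟩ := (Completion.denseRange_coe (α := P)).exists_dist_lt (show Completion P from x) hε
  refine ⟨y, ?_⟩
  rw [dist_eq_norm, norm_completion] at hy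
  exact hy

end Completion

end PreHilbertBimodule

/-! ### Right-Hilbert bimodules, their isomorphisms, imprimitivity bimodules -/

/-- Completeness of a vector space with respect to a (norm-like) function `q`: every sequence that
is Cauchy for `q (x - y)` converges. -/
def SeqComplete {X : Type*} [AddCommGroup X] (q : X → ℝ) : Prop :=
  ∀ u : ℕ → X, (∀ ε > 0, ∃ N, ∀ m ≥ N, ∀ n ≥ N, q (u m - u n) < ε) →
    ∃ x, ∀ ε > 0, ∃ N, ∀ n ≥ N, q (u n - x) < ε

/-- A right-Hilbert `A`-`B` bimodule: a full Hilbert `B`-module with a nondegenerate left action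
of `A` by adjointable operators. -/
structure RightHilbertBimodule (A B : Type u) [NonUnitalCStarAlgebra A]
    [NonUnitalCStarAlgebra B] extends PreHilbertBimodule A B where
  inner_self_eq_zero : ∀ x, inner x x = 0 → x = 0
  complete : SeqComplete fun x => √‖inner x x‖
  full : Dense (Submodule.span ℂ {b : B | ∃ x y, inner x y = b} : Set B)
  /-- `A · X` spans a dense subspace, for the norm `‖x‖ = ‖⟪x, x⟫_B‖ ^ (1/2)`. -/
  nondegenerate : ∀ x, ∀ ε > 0, ∃ z ∈ Submodule.span ℂ {z : carrier | ∃ a x', lact a x' = z},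
    √‖inner (x - z) (x - z)‖ < ε

namespace RightHilbertBimodule

variable {A B C D : Type u} [NonUnitalCStarAlgebra A] [NonUnitalCStarAlgebra B]
  [NonUnitalCStarAlgebra C] [NonUnitalCStarAlgebra D]

instance : CoeSort (RightHilbertBimodule A B) (Type u) := ⟨fun X => X.carrier⟩

/-- An isomorphism of right-Hilbert bimodules. -/
structure Iso (X Y : RightHilbertBimodule A B) where
  /-- The underlying linear bijection. -/
  toLinearEquiv : X ≃ₗ[ℂ] Y
  map_lact : ∀ a x, toLinearEquiv (X.lact a x) = Y.lact a (toLinearEquiv x)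
  map_ract : ∀ x b, toLinearEquiv (X.ract x b) = Y.ract (toLinearEquiv x) b
  map_inner : ∀ x y, Y.inner (toLinearEquiv x) (toLinearEquiv y) = X.inner x y

/-- `l` makes `X`, with its given left `A`-action, a full left-Hilbert `A`-module: `l` is an
`A`-valued positive definite form, linear in the first and conjugate-linear in the second variable,
and `X` is complete in the norm `‖l x x‖ ^ (1/2)`. -/
structure IsLeftHilbert (X : RightHilbertBimodule A B) (l : X →ₗ[ℂ] X →ₗ⋆[ℂ] A) : Prop where
  lact_left : ∀ a x y, l (X.lact a x) y = a * l x y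
  star_form : ∀ x y, star (l x y) = l y x
  self_pos : ∀ x, IsPos (l x x)
  self_eq_zero : ∀ x, l x x = 0 → x = 0
  complete : SeqComplete fun x => √‖l x x‖
  full : Dense (Submodule.span ℂ {a : A | ∃ x y, l x y = a} : Set A)

/-- `X` is an `A`-`B` imprimitivity bimodule: it is also a full left-Hilbert `A`-module, with
`_A⟪x, y⟫ · z = x · ⟪y, z⟫_B` and `_A⟪x · b, y⟫ = _A⟪x, y · b⋆⟫`. -/
def IsImprimitivityBimodule (X : RightHilbertBimodule A B) : Prop :=
  ∃ l : X →ₗ[ℂ] X →ₗ⋆[ℂ] A, X.IsLeftHilbert l ∧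
    (∀ x y z, X.lact (l x y) z = X.ract x (X.inner y z)) ∧
    (∀ x y b, l (X.ract x b) y = l x (X.ract y (star b)))

/-! Topology of right-Hilbert bimodules and construction of isomorphisms. -/

section Norm

noncomputable instance (X : RightHilbertBimodule A B) : NormedAddCommGroup X :=
  { (inferInstance : SeminormedAddCommGroup X.toPreHilbertBimodule) with
    eq_of_dist_eq_zero := by
      intro x y h
      rw [dist_eq_norm, PreHilbertBimodule.norm_def, Real.sqrt_eq_zero (norm_nonneg _),
        norm_eq_zero] at h
      exact sub_eq_zero.1 (X.inner_self_eq_zero _ h) }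

instance (X : RightHilbertBimodule A B) : CompleteSpace X := by
  refine Metric.complete_of_cauchySeq_tendsto fun u hu => ?_
  obtain ⟨x, hx⟩ := X.complete u fun ε hε => by
    obtain ⟨N, hN⟩ := Metric.cauchySeq_iff.1 hu ε hε
    refine ⟨N, fun m hm n hn => ?_⟩
    have := hN m hm n hn
    rwa [dist_eq_norm] at this
  refine ⟨x, Metric.tendsto_atTop.2 fun ε hε => ?_⟩
  obtain ⟨N, hN⟩ := hx ε hε
  refine ⟨N, fun n hn => ?_⟩
  rw [dist_eq_norm]
  exact hN n hn

/-- A linear bijection preserving the left action and the form preserves the right action. -/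
noncomputable def Iso.mk' {X Y : RightHilbertBimodule A B} (e : X ≃ₗ[ℂ] Y)
    (hl : ∀ a x, e (X.lact a x) = Y.lact a (e x)) (hi : ∀ x y, Y.inner (e x) (e y) = X.inner x y) :
    Iso X Y where
  toLinearEquiv := e
  map_lact := hl
  map_inner := hi
  map_ract x b := by
    have hi' : ∀ x y, Y.inner x (e y) = X.inner (e.symm x) y := fun x y => by
      rw [← hi, e.apply_symm_apply]
    refine sub_eq_zero.1 (Y.inner_self_eq_zero _ ?_)
    obtain ⟨w, hw⟩ : ∃ w, e w = e (X.ract x b) - Y.ract (e x) b := ⟨_, e.apply_symm_apply _⟩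
    have h : ∀ w, Y.inner (e w) (e (X.ract x b) - Y.ract (e x) b) = 0 := fun w => by
      rw [map_sub, hi, X.inner_ract, Y.inner_ract, hi, sub_self]
    nth_rewrite 1 [← hw]
    exact h w

/-- Two right-Hilbert bimodules that contain dense images of one vector space, with the same
values of the forms and matching left actions, are isomorphic. -/
noncomputable def Iso.ofDense {X Y : RightHilbertBimodule A B} {T : Type*} [AddCommGroup T]
    [Module ℂ T] (f : T →ₗ[ℂ] X) (g : T →ₗ[ℂ] Y) (hf : DenseRange f) (hg : DenseRange g)
    (act : A → T → T) (hfa : ∀ a t, f (act a t) = X.lact a (f t))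
    (hga : ∀ a t, g (act a t) = Y.lact a (g t))
    (hfg : ∀ s t, X.inner (f s) (f t) = Y.inner (g s) (g t)) : Iso X Y :=
  let e : X ≃ₗᵢ[ℂ] Y := (LinearEquiv.refl ℂ T).extendOfIsometry f g hf hg (fun x => by
    rw [PreHilbertBimodule.norm_def, PreHilbertBimodule.norm_def, hfg]; rfl)
  have he : ∀ t, e (f t) = g t := fun t =>
    LinearEquiv.extendOfIsometry_eq (LinearEquiv.refl ℂ T) f g hf hg _ t
  Iso.mk' e.toLinearEquiv
    (fun a x => by
      refine hf.induction_on (p := fun x => e (X.lact a x) = Y.lact a (e x)) x ?_ fun t => ?_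
      · exact isClosed_eq (e.continuous.comp (X.lactL a).continuous)
          ((Y.lactL a).continuous.comp e.continuous)
      · rw [← hfa, he, he, hga])
    (fun x y => by
      refine hf.induction_on₂ (p := fun x y => Y.inner (e x) (e y) = X.inner x y) ?_
        (fun s t => ?_) x y
      · refine isClosed_eq ?_ ?_
        · have : Continuous fun p : X × X => Y.innerL (e p.1) (e p.2) := by fun_prop
          exact this
        · have : Continuous fun p : X × X => X.innerL p.1 p.2 := by fun_prop
          exact this
      · rw [he, he, hfg])

/-- The identity isomorphism. -/
def Iso.refl (X : RightHilbertBimodule A B) : Iso X X :=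
  ⟨LinearEquiv.refl ℂ X, fun _ _ => rfl, fun _ _ => rfl, fun _ _ => rfl⟩

/-- The inverse isomorphism. -/
def Iso.symm {X Y : RightHilbertBimodule A B} (e : Iso X Y) : Iso Y X :=
  ⟨e.toLinearEquiv.symm,
    fun a x => e.toLinearEquiv.injective (by simp [e.map_lact]),
    fun x b => e.toLinearEquiv.injective (by simp [e.map_ract]),
    fun x y => by simp [← e.map_inner]⟩

/-- The composite isomorphism. -/
def Iso.trans {X Y Z : RightHilbertBimodule A B} (e : Iso X Y) (f : Iso Y Z) : Iso X Z :=
  ⟨e.toLinearEquiv.trans f.toLinearEquiv,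
    fun a x => by simp [e.map_lact, f.map_lact],
    fun x b => by simp [e.map_ract, f.map_ract],
    fun x y => by simp [e.map_inner, f.map_inner]⟩

end Norm

end RightHilbertBimodule

/-- The right-Hilbert bimodule obtained from a right-pre-Hilbert bimodule by dividing out the
vectors of length zero and completing. -/
noncomputable def PreHilbertBimodule.toRightHilbertBimodule {A B : Type u}
    [NonUnitalCStarAlgebra A] [NonUnitalCStarAlgebra B] (P : PreHilbertBimodule A B)
    (full : Dense (Submodule.span ℂ {b : B | ∃ x y, P.inner x y = b} : Set B))
    (nondeg : Dense (Submodule.span ℂ {z : P | ∃ a x, P.lact a x = z} : Set P)) :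
    RightHilbertBimodule A B where
  toPreHilbertBimodule := P.compl
  inner_self_eq_zero x hx := by
    have h : ‖(show UniformSpace.Completion P from x)‖ = 0 := by
      rw [P.norm_completion]
      have : P.innerC x x = 0 := hx
      rw [this, norm_zero, Real.sqrt_zero]
    exact norm_eq_zero.1 h
  complete u hu := by
    let v : ℕ → UniformSpace.Completion P := u
    have hv : CauchySeq v := by
      refine Metric.cauchySeq_iff.2 fun ε hε => ?_
      obtain ⟨N, hN⟩ := hu ε hε
      refine ⟨N, fun m hm n hn => ?_⟩
      rw [dist_eq_norm, P.norm_completion]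
      exact hN m hm n hn
    obtain ⟨x, hx⟩ := cauchySeq_tendsto_of_complete hv
    refine ⟨x, fun ε hε => ?_⟩
    obtain ⟨N, hN⟩ := Metric.tendsto_atTop.1 hx ε hε
    refine ⟨N, fun n hn => ?_⟩
    have := hN n hn
    rw [dist_eq_norm, P.norm_completion] at this
    exact this
  full := by
    refine full.mono (Submodule.span_mono ?_)
    rintro _ ⟨x, y, rfl⟩
    exact ⟨P.toCompl x, P.toCompl y, P.inner_toCompl x y⟩
  nondegenerate := by
    intro x ε hε
    obtain ⟨y, hy⟩ := P.denseRange_toCompl x (ε / 2) (by positivity)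
    obtain ⟨z, hz, hz'⟩ := Metric.dense_iff.1 nondeg y (ε / 2) (by positivity)
    refine ⟨P.toCompl z, ?_, ?_⟩
    rotate_left
    · change ‖x - P.toCompl z‖ < ε
      rw [Metric.mem_ball, dist_comm, dist_eq_norm] at hz
      calc ‖x - P.toCompl z‖ = ‖(x - P.toCompl y) + P.toCompl (y - z)‖ := by
            rw [map_sub]; congr 1; abel
        _ ≤ ‖x - P.toCompl y‖ + ‖P.toCompl (y - z)‖ := norm_add_le _ _
        _ < ε := by rw [P.norm_toCompl]; linarith
    · have h : Submodule.span ℂ {z : P | ∃ a x, P.lact a x = z} ≤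
          (Submodule.span ℂ {z : P.compl | ∃ a x, P.compl.lact a x = z}).comap P.toCompl := by
        refine Submodule.span_le.2 ?_
        rintro _ ⟨a, x, rfl⟩
        exact Submodule.subset_span ⟨a, P.toCompl x, P.lact_toCompl a x⟩
      exact h hz'

/-! ### The internal tensor product -/

namespace PreHilbertBimodule

variable {A B C : Type u} [NonUnitalCStarAlgebra A] [NonUnitalCStarAlgebra B]
  [NonUnitalCStarAlgebra C]

theorem exists_negPart {M : Type*} [NonUnitalCStarAlgebra M] {g : M} (hg : IsSelfAdjoint g) :
    ∃ N S : M, star N = N ∧ N = star S * S ∧ star N * g * N = -(star (S * N) * (S * N)) ∧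
      (N = 0 → IsPos g) := by
  let _ : PartialOrder M := CStarAlgebra.spectralOrder M
  have : StarOrderedRing M := CStarAlgebra.spectralOrderedRing M
  have hN0 : 0 ≤ g⁻ := CFC.negPart_nonneg g
  have hNsa : star g⁻ = g⁻ := (IsSelfAdjoint.of_nonneg hN0).star_eq
  obtain ⟨S, hS⟩ : IsPos g⁻ := isPos_iff_nonneg.2 hN0
  refine ⟨g⁻, S, hNsa, hS, ?_, fun h => isPos_iff_nonneg.2 ((CFC.negPart_eq_zero_iff g).1 h)⟩
  have h2 : g⁺ - g⁻ = g := CFC.posPart_sub_negPart g hg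
  have h3 : g⁺ * g⁻ = 0 := CFC.posPart_mul_negPart g
  rw [star_mul, hNsa]
  calc g⁻ * g * g⁻ = g⁻ * (g⁺ - g⁻) * g⁻ := by rw [h2]
    _ = g⁻ * (g⁺ * g⁻) - g⁻ * g⁻ * g⁻ := by noncomm_ring
    _ = - (g⁻ * (star S * S) * g⁻) := by rw [h3, ← hS, mul_zero, zero_sub]
    _ = _ := by simp only [mul_assoc]

/-- Gram matrices over a C⋆-algebra are positive. -/
theorem exists_gram (P : PreHilbertBimodule A B) {n : ℕ} (x : Fin n → P) :
    ∃ m : Fin n → Fin n → B, ∀ i j, P.inner (x i) (x j) = ∑ k, star (m k i) * m k j := by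
  let _ : PartialOrder B := CStarAlgebra.spectralOrder B
  have : StarOrderedRing B := CStarAlgebra.spectralOrderedRing B
  let G : CStarMatrix (Fin n) (Fin n) B := CStarMatrix.ofMatrix (Matrix.of fun i j => P.inner (x i) (x j))
  have hG : ∀ i j, G i j = P.inner (x i) (x j) := fun _ _ => rfl
  have hGsa : IsSelfAdjoint G := by
    ext i j
    rw [CStarMatrix.star_apply, hG, hG, P.star_inner]
  have hGpos : IsPos G := by
    obtain ⟨N, S, hNsa, hS, h1, h0⟩ := exists_negPart hGsa
    refine h0 ?_
    let x' : Fin n → P := fun j => ∑ l, P.ract (x l) (N l j)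
    have h5 : ∀ i j, (star N * G * N) i j = P.inner (x' i) (x' j) := by
      intro i j
      simp only [CStarMatrix.mul_apply, CStarMatrix.star_apply, hG, x', map_sum,
        LinearMap.sum_apply, P.inner_ract, P.inner_ract_left, Finset.sum_mul]
    have h6 : ∀ i, x' i = x' i ∧ P.inner (x' i) (x' i) = 0 := by
      intro i
      refine ⟨rfl, le_antisymm ?_ (isPos_iff_nonneg.1 (P.inner_self_pos _))⟩
      rw [← h5, h1, CStarMatrix.neg_apply, neg_nonpos, CStarMatrix.mul_apply]
      exact Finset.sum_nonneg fun k _ => by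
        rw [CStarMatrix.star_apply]; exact star_mul_self_nonneg _
    have h7 : star N * G * N = 0 := by
      ext i j
      rw [h5, CStarMatrix.zero_apply]
      have := P.sq_norm_inner_le (x' i) (x' j)
      rw [(h6 i).2, norm_zero, zero_mul] at this
      exact norm_eq_zero.1 (pow_eq_zero_iff two_ne_zero |>.1 (le_antisymm this (sq_nonneg _)))
    have h8 : S * N = 0 := by
      rw [h1, neg_eq_zero] at h7
      exact CStarRing.star_mul_self_eq_zero_iff _ |>.1 h7
    have h9 : N * N = 0 := by rw [hS] at h8 ⊢; rw [mul_assoc, h8, mul_zero]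
    nth_rewrite 1 [← hNsa] at h9
    exact CStarRing.star_mul_self_eq_zero_iff _ |>.1 h9
  obtain ⟨M, hM⟩ := hGpos
  refine ⟨fun k i => M k i, fun i j => ?_⟩
  rw [← hG, hM, CStarMatrix.mul_apply]
  simp [CStarMatrix.star_apply]

variable (X : PreHilbertBimodule A B) (Y : PreHilbertBimodule B C)

/-- For fixed `x ∈ X` and `y ∈ Y` the linear map `z ⊗ w ↦ ⟪y, ⟪x, z⟫_B · w⟫_C`. -/
noncomputable def tensorInnerAux (x : X) (y : Y) : (X ⊗[ℂ] Y) →ₗ[ℂ] C :=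
  TensorProduct.lift (LinearMap.mk₂ ℂ (fun z w => Y.inner y (Y.lact (X.inner x z) w))
    (by simp) (by simp) (by simp) (by simp))

/-- The form on the algebraic tensor product,
`⟪x ⊗ y, z ⊗ w⟫_C = ⟪y, ⟪x, z⟫_B · w⟫_C`. -/
noncomputable def tensorInner : (X ⊗[ℂ] Y) →ₗ⋆[ℂ] (X ⊗[ℂ] Y) →ₗ[ℂ] C :=
  TensorProduct.lift (LinearMap.mk₂'ₛₗ (starRingEnd ℂ) (starRingEnd ℂ)
    (fun x y => tensorInnerAux X Y x y)
    (fun x x' y => by ext; simp [tensorInnerAux]) (fun c x y => by ext; simp [tensorInnerAux])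
    (fun x y y' => by ext; simp [tensorInnerAux]) (fun c x y => by ext; simp [tensorInnerAux]))

@[simp] theorem tensorInner_tmul (x z : X) (y w : Y) :
    tensorInner X Y (x ⊗ₜ y) (z ⊗ₜ w) = Y.inner y (Y.lact (X.inner x z) w) := by
  simp [tensorInner, tensorInnerAux]

theorem tensorInner_self_pos (t : X ⊗[ℂ] Y) : IsPos (tensorInner X Y t t) := by
  obtain ⟨n, x, y, rfl⟩ := TensorProduct.exists_sum_tmul_eq t
  obtain ⟨m, hm⟩ := X.exists_gram x
  have h : tensorInner X Y (∑ i, x i ⊗ₜ y i) (∑ i, x i ⊗ₜ y i)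
      = ∑ k, Y.inner (∑ i, Y.lact (m k i) (y i)) (∑ i, Y.lact (m k i) (y i)) := by
    simp only [map_sum, LinearMap.sum_apply, tensorInner_tmul, hm, Y.inner_lact, Y.lact_mul]
    exact (Finset.sum_congr rfl fun j _ => Finset.sum_comm).trans Finset.sum_comm
  rw [h]
  exact IsPos.sum _ fun k _ => Y.inner_self_pos _

/-- The algebraic tensor product `X ⊙ Y` as a right-pre-Hilbert `A`-`C` bimodule:
`a · (x ⊗ y) = (a · x) ⊗ y`, `(x ⊗ y) · c = x ⊗ (y · c)` and
`⟪x ⊗ y, z ⊗ w⟫_C = ⟪y, ⟪x, z⟫_B · w⟫_C`. -/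
noncomputable def tensor : PreHilbertBimodule A C where
  carrier := X ⊗[ℂ] Y
  lact := (LinearMap.rTensorHom Y).comp X.lact
  ract := ((LinearMap.lTensorHom X).comp Y.ract.flip).flip
  inner := tensorInner X Y
  lact_mul a a' t := by
    induction t with
    | zero => simp
    | tmul x y => simp [X.lact_mul]
    | add s t hs ht => rw [map_add, map_add, map_add, hs, ht]
  ract_mul t b b' := by
    induction t with
    | zero => simp
    | tmul x y => simp [Y.ract_mul]
    | add s t hs ht => simp only [map_add, LinearMap.add_apply, hs, ht]
  lact_ract a t b := by
    induction t with
    | zero => simp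
    | tmul x y => simp
    | add s t hs ht => simp only [map_add, LinearMap.add_apply, hs, ht]
  inner_ract s t c := by
    induction s with
    | zero => simp
    | add s s' hs hs' => simp only [map_add, LinearMap.add_apply, hs, hs', add_mul]
    | tmul x y =>
      induction t with
      | zero => simp
      | tmul z w => simp [Y.lact_ract, Y.inner_ract]
      | add s t hs ht => simp only [map_add, LinearMap.add_apply, hs, ht, add_mul]
  star_inner s t := by
    induction s with
    | zero => simp
    | add s s' hs hs' => simp only [map_add, LinearMap.add_apply, hs, hs', star_add]
    | tmul x y =>
      induction t with
      | zero => simp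
      | tmul z w =>
        simp only [tensorInner_tmul]
        rw [Y.star_inner, Y.inner_lact, X.star_inner]
      | add s t hs ht => simp only [map_add, LinearMap.add_apply, hs, ht, star_add]
  inner_lact a s t := by
    induction s with
    | zero => simp
    | add s s' hs hs' => simp only [map_add, LinearMap.add_apply, hs, hs']
    | tmul x y =>
      induction t with
      | zero => simp
      | tmul z w => simp [X.inner_lact]
      | add s t hs ht => simp only [map_add, hs, ht]
  inner_self_pos := tensorInner_self_pos X Y

/-- The elementary tensor `x ⊗ y` in the pre-Hilbert bimodule `X ⊙ Y`. -/
noncomputable def tm (x : X) (y : Y) : tensor X Y := x ⊗ₜ[ℂ] y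

theorem lact_tm (a : A) (x : X) (y : Y) :
    (tensor X Y).lact a (tm X Y x y) = tm X Y (X.lact a x) y := rfl

theorem ract_tm (x : X) (y : Y) (c : C) :
    (tensor X Y).ract (tm X Y x y) c = tm X Y x (Y.ract y c) := rfl

theorem inner_tm (x z : X) (y w : Y) :
    (tensor X Y).inner (tm X Y x y) (tm X Y z w) = Y.inner y (Y.lact (X.inner x z) w) :=
  tensorInner_tmul X Y x z y w

theorem norm_tm_le (x : X) (y : Y) : ‖tm X Y x y‖ ≤ ‖x‖ * ‖y‖ := by
  refine (sq_le_sq₀ (norm_nonneg _) (by positivity)).1 ?_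
  rw [sq_norm, inner_tm]
  calc _ ≤ ‖y‖ * (‖X.inner x x‖ * ‖y‖) :=
        (Y.norm_inner_le' _ _).trans (by gcongr; exact Y.norm_lact_le _ _)
    _ = _ := by rw [← X.sq_norm]; ring

/-- `x ↦ x ⊗ y` as a bounded operator. -/
noncomputable def tmL (y : Y) : X →L[ℂ] tensor X Y :=
  LinearMap.mkContinuous
    (show X →ₗ[ℂ] X ⊗[ℂ] Y from (TensorProduct.mk ℂ X Y).flip y : X →ₗ[ℂ] tensor X Y) ‖y‖
    fun x => by rw [mul_comm]; exact norm_tm_le X Y x y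

/-- `y ↦ x ⊗ y` as a bounded operator. -/
noncomputable def tmR (x : X) : Y →L[ℂ] tensor X Y :=
  LinearMap.mkContinuous
    (show Y →ₗ[ℂ] X ⊗[ℂ] Y from TensorProduct.mk ℂ X Y x : Y →ₗ[ℂ] tensor X Y) ‖x‖
    fun y => norm_tm_le X Y x y

@[simp] theorem tmL_apply (x : X) (y : Y) : tmL X Y y x = tm X Y x y := rfl
@[simp] theorem tmR_apply (x : X) (y : Y) : tmR X Y x y = tm X Y x y := rfl

@[elab_as_elim]
theorem tensor_induction {p : tensor X Y → Prop} (t : tensor X Y) (h0 : p 0)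
    (ht : ∀ x y, p (tm X Y x y)) (ha : ∀ s t, p s → p t → p (s + t)) : p t :=
  TensorProduct.induction_on (motive := p) t h0 ht ha

end PreHilbertBimodule

theorem mem_of_dense_span {E F : Type*} [SeminormedAddCommGroup E] [NormedSpace ℂ E]
    [SeminormedAddCommGroup F] [NormedSpace ℂ F] {S : Set E}
    (hS : Dense (Submodule.span ℂ S : Set E)) (f : E →L[ℂ] F) (W : Submodule ℂ F)
    (hW : IsClosed (W : Set F)) (h : ∀ s ∈ S, f s ∈ W) (e : E) : f e ∈ W := by
  have h1 : Submodule.span ℂ S ≤ W.comap (f : E →ₗ[ℂ] F) := Submodule.span_le.2 h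
  have h2 : IsClosed (f ⁻¹' (W : Set F)) := hW.preimage f.continuous
  have h3 : (f ⁻¹' (W : Set F)) = Set.univ :=
    h2.closure_eq ▸ (hS.mono (s₂ := f ⁻¹' (W : Set F)) h1).closure_eq
  exact (h3 ▸ Set.mem_univ e : e ∈ f ⁻¹' (W : Set F))

namespace RightHilbertBimodule

open PreHilbertBimodule

variable {A B C D : Type u} [NonUnitalCStarAlgebra A] [NonUnitalCStarAlgebra B]
  [NonUnitalCStarAlgebra C] [NonUnitalCStarAlgebra D]

theorem dense_lact (X : RightHilbertBimodule A B) :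
    Dense (Submodule.span ℂ {z : X | ∃ a x, X.lact a x = z} :
      Set X.toPreHilbertBimodule) := by
  refine Metric.dense_iff.2 fun x ε hε => ?_
  obtain ⟨z, hz, h⟩ := X.nondegenerate x ε hε
  refine ⟨z, ?_, hz⟩
  rw [Metric.mem_ball, dist_comm, dist_eq_norm]
  exact h

section Tensor

variable (X : RightHilbertBimodule A B) (Y : RightHilbertBimodule B C)

theorem tensor_full : Dense (Submodule.span ℂ
    {c : C | ∃ s t, (PreHilbertBimodule.tensor X.toPreHilbertBimodule Y.toPreHilbertBimodule).inner
      s t = c} : Set C) := by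
  set V := Submodule.span ℂ
    {c : C | ∃ s t, (PreHilbertBimodule.tensor X.toPreHilbertBimodule Y.toPreHilbertBimodule).inner
      s t = c} with hV
  set W := V.topologicalClosure
  have hW : IsClosed (W : Set C) := V.isClosed_topologicalClosure
  have h1 : ∀ (y y' : Y) (b : B), Y.inner y (Y.lact b y') ∈ W := by
    intro y y' b
    let f : B →L[ℂ] C := (Y.innerL y).comp
      ((Y.lact.flip y').mkContinuous ‖y'‖ fun b => by
        rw [mul_comm]; exact Y.norm_lact_le b y')
    refine mem_of_dense_span X.full f W hW ?_ b
    rintro _ ⟨x, z, rfl⟩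
    refine V.le_topologicalClosure (Submodule.subset_span ?_)
    exact ⟨tm _ _ x y, tm _ _ z y', inner_tm _ _ x z y y'⟩
  have h2 : ∀ y w : Y, Y.inner y w ∈ W := by
    intro y w
    refine mem_of_dense_span Y.dense_lact (Y.innerL y) W hW ?_ w
    rintro _ ⟨b, y', rfl⟩
    exact h1 y y' b
  have h3 : ∀ c : C, c ∈ W := by
    intro c
    refine mem_of_dense_span Y.full (ContinuousLinearMap.id ℂ C) W hW ?_ c
    rintro _ ⟨y, w, rfl⟩
    exact h2 y w
  exact fun c => h3 c

theorem tensor_nondegenerate : Dense (Submodule.span ℂ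
    {z : PreHilbertBimodule.tensor X.toPreHilbertBimodule Y.toPreHilbertBimodule | ∃ a t,
      (PreHilbertBimodule.tensor X.toPreHilbertBimodule Y.toPreHilbertBimodule).lact a t = z} :
      Set (PreHilbertBimodule.tensor X.toPreHilbertBimodule Y.toPreHilbertBimodule)) := by
  set V := Submodule.span ℂ
    {z : PreHilbertBimodule.tensor X.toPreHilbertBimodule Y.toPreHilbertBimodule | ∃ a t,
      (PreHilbertBimodule.tensor X.toPreHilbertBimodule Y.toPreHilbertBimodule).lact a t = z}
  set W := V.topologicalClosure
  have hW := V.isClosed_topologicalClosure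
  have h1 : ∀ t, t ∈ W := by
    intro t
    refine tensor_induction _ _ t W.zero_mem (fun x y => ?_) fun s t hs ht => W.add_mem hs ht
    refine mem_of_dense_span X.dense_lact (tmL _ _ y) W hW ?_ x
    rintro _ ⟨a, x', rfl⟩
    exact V.le_topologicalClosure (Submodule.subset_span ⟨a, tm _ _ x' y, rfl⟩)
  exact fun t => h1 t

/-- The internal (balanced) tensor product `X ⊗_B Y`: the algebraic tensor product `X ⊙ Y`, with
`⟪x ⊗ y, z ⊗ w⟫_C = ⟪y, ⟪x, z⟫_B · w⟫_C`, modulo vectors of length zero and completed. -/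
noncomputable def tensor : RightHilbertBimodule A C :=
  (PreHilbertBimodule.tensor X.toPreHilbertBimodule Y.toPreHilbertBimodule).toRightHilbertBimodule
    (tensor_full X Y) (tensor_nondegenerate X Y)

/-- The canonical linear map `X ⊙ Y → X ⊗_B Y`. -/
noncomputable def ofTensor : X ⊗[ℂ] Y →ₗ[ℂ] tensor X Y :=
  (PreHilbertBimodule.tensor X.toPreHilbertBimodule Y.toPreHilbertBimodule).toCompl

/-- The image of `x ⊗ y` in `X ⊗_B Y`. -/
noncomputable def tmul (x : X) (y : Y) : tensor X Y := ofTensor X Y (x ⊗ₜ[ℂ] y)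

theorem ofTensor_tmul (x : X) (y : Y) : ofTensor X Y (x ⊗ₜ[ℂ] y) = tmul X Y x y := rfl

theorem denseRange_ofTensor : DenseRange (ofTensor X Y) := by
  refine Metric.denseRange_iff.2 fun z ε hε => ?_
  obtain ⟨t, ht⟩ := (PreHilbertBimodule.tensor X.toPreHilbertBimodule
    Y.toPreHilbertBimodule).denseRange_toCompl z ε hε
  refine ⟨t, ?_⟩
  rw [dist_eq_norm]
  exact ht

theorem lact_tmul (a : A) (x : X) (y : Y) :
    (tensor X Y).lact a (tmul X Y x y) = tmul X Y (X.lact a x) y :=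
  PreHilbertBimodule.lact_toCompl _ a _

theorem lact_ofTensor (a : A) (t : X ⊗[ℂ] Y) :
    (tensor X Y).lact a (ofTensor X Y t) = ofTensor X Y (LinearMap.rTensor Y (X.lact a) t) :=
  PreHilbertBimodule.lact_toCompl _ a _

theorem ract_tmul (x : X) (y : Y) (c : C) :
    (tensor X Y).ract (tmul X Y x y) c = tmul X Y x (Y.ract y c) :=
  PreHilbertBimodule.ract_toCompl _ _ c

theorem inner_tmul (x z : X) (y w : Y) :
    (tensor X Y).inner (tmul X Y x y) (tmul X Y z w) = Y.inner y (Y.lact (X.inner x z) w) :=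
  (PreHilbertBimodule.inner_toCompl _ _ _).trans (inner_tm _ _ x z y w)

theorem norm_tmul_le (x : X) (y : Y) : ‖tmul X Y x y‖ ≤ ‖x‖ * ‖y‖ :=
  (PreHilbertBimodule.norm_toCompl _ (tm _ _ x y)).trans_le (norm_tm_le _ _ x y)

end Tensor

/-- Two linear maps out of an algebraic tensor product that agree in inner product on elementary
tensors agree in inner product everywhere. -/
theorem inner_eq_of_tmul {M N : Type u} [AddCommGroup M] [Module ℂ M] [AddCommGroup N] [Module ℂ N]
    {X X' : RightHilbertBimodule A B} (f : M ⊗[ℂ] N →ₗ[ℂ] X) (g : M ⊗[ℂ] N →ₗ[ℂ] X')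
    (h : ∀ m n m' n', X.inner (f (m ⊗ₜ n)) (f (m' ⊗ₜ n')) = X'.inner (g (m ⊗ₜ n)) (g (m' ⊗ₜ n')))
    (s t : M ⊗[ℂ] N) : X.inner (f s) (f t) = X'.inner (g s) (g t) := by
  induction s with
  | zero => simp
  | add s s' hs hs' => simp only [map_add, LinearMap.add_apply, hs, hs']
  | tmul m n =>
    induction t with
    | zero => simp
    | add t t' ht ht' => simp only [map_add, ht, ht']
    | tmul m' n' => exact h m n m' n'

/-- The internal tensor product respects isomorphism. -/
noncomputable def Iso.tensor {X X' : RightHilbertBimodule A B} {Y Y' : RightHilbertBimodule B C}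
    (e : Iso X X') (f : Iso Y Y') : Iso (X.tensor Y) (X'.tensor Y') :=
  Iso.ofDense (ofTensor X Y)
    ((ofTensor X' Y').comp (TensorProduct.congr e.toLinearEquiv f.toLinearEquiv).toLinearMap)
    (denseRange_ofTensor X Y)
    (by
      rw [DenseRange, LinearMap.coe_comp, LinearEquiv.coe_coe,
        Function.Surjective.range_comp (LinearEquiv.surjective _)]
      exact denseRange_ofTensor X' Y')
    (fun a t => LinearMap.rTensor Y (X.lact a) t)
    (fun a t => (lact_ofTensor X Y a t).symm)
    (fun a t => by
      rw [LinearMap.comp_apply, LinearMap.comp_apply, lact_ofTensor]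
      congr 1
      induction t with
      | zero => simp
      | tmul x y => simp [e.map_lact]
      | add s t hs ht => rw [map_add, map_add, hs, ht, map_add, map_add])
    (inner_eq_of_tmul _ _ fun x y z w => by
      simp only [LinearMap.comp_apply, LinearEquiv.coe_coe, TensorProduct.congr_tmul, ofTensor_tmul,
        inner_tmul, e.map_inner, ← f.map_lact, f.map_inner])

/-- A linear map from an algebraic tensor product that approximates all elementary tensors of an
internal tensor product has dense range. -/
theorem denseRange_of_tmul {T : Type u} [AddCommGroup T] [Module ℂ T]
    {X : RightHilbertBimodule A B} {Y : RightHilbertBimodule B C} (f : T →ₗ[ℂ] X.tensor Y)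
    (h : ∀ x y, ∀ ε > 0, ∃ t, ‖ofTensor X Y (x ⊗ₜ[ℂ] y) - f t‖ < ε) : DenseRange f := by
  set W := (LinearMap.range f).topologicalClosure with hW
  have h1 : ∀ s, ofTensor X Y s ∈ W := by
    intro s
    induction s with
    | zero => rw [map_zero]; exact W.zero_mem
    | add s t hs ht => rw [map_add]; exact W.add_mem hs ht
    | tmul x y =>
      refine Metric.mem_closure_iff.2 fun ε hε => ?_
      obtain ⟨t, ht⟩ := h x y ε hε
      exact ⟨f t, ⟨t, rfl⟩, by rwa [dist_eq_norm]⟩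
  have h2 : IsClosed (W : Set (X.tensor Y)) := Submodule.isClosed_topologicalClosure _
  intro z
  have h3 : z ∈ W :=
    (denseRange_ofTensor X Y).induction_on (p := fun z => z ∈ W) z h2 h1
  exact h3

/-! ### The identity bimodule -/

theorem exists_approx_unit {A : Type u} [NonUnitalCStarAlgebra A] (a : A) {ε : ℝ} (hε : 0 < ε) :
    ∃ e : A, ‖e‖ ≤ 1 ∧ ‖a - a * e‖ < ε := by
  let _ : PartialOrder A := CStarAlgebra.spectralOrder A
  have : StarOrderedRing A := CStarAlgebra.spectralOrderedRing A
  have h := CStarAlgebra.increasingApproximateUnit A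
  have h1 := (Metric.tendsto_nhds.1 (h.tendsto_mul_left a) ε hε).and h.eventually_norm
  have := h.neBot
  obtain ⟨e, he, he'⟩ := h1.exists
  exact ⟨e, he', by rwa [← dist_eq_norm, dist_comm]⟩

theorem exists_approx_ract (X : RightHilbertBimodule A B) (x : X) {ε : ℝ} (hε : 0 < ε) :
    ∃ e : B, ‖x - X.ract x e‖ < ε := by
  obtain ⟨e, he, he'⟩ := exists_approx_unit (X.inner x x) (ε := ε ^ 2 / 2) (by positivity)
  refine ⟨e, (sq_lt_sq₀ (norm_nonneg _) hε.le).1 ?_⟩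
  rw [sq_norm]
  have h : X.inner (x - X.ract x e) (x - X.ract x e) =
      (X.inner x x - X.inner x x * e) - star e * (X.inner x x - X.inner x x * e) := by
    simp only [map_sub, LinearMap.sub_apply, X.inner_ract, X.inner_ract_left, mul_sub, mul_assoc]
    abel
  rw [h]
  calc _ ≤ ‖X.inner x x - X.inner x x * e‖ + ‖star e‖ * ‖X.inner x x - X.inner x x * e‖ :=
        (norm_sub_le _ _).trans (by gcongr; exact norm_mul_le _ _)
    _ < ε ^ 2 := by
      rw [norm_star]
      nlinarith [norm_nonneg (X.inner x x - X.inner x x * e)]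


/-- The right-Hilbert bimodule `_A A_A`, with `⟪a, b⟫ = a⋆ b`. -/
noncomputable def identity (A : Type u) [NonUnitalCStarAlgebra A] : RightHilbertBimodule A A where
  carrier := A
  lact := LinearMap.mul ℂ A
  ract := LinearMap.mul ℂ A
  inner := LinearMap.mk₂'ₛₗ (starRingEnd ℂ) (RingHom.id ℂ) (fun a b => star a * b)
    (by simp [add_mul]) (by simp [smul_mul_assoc])
    (by simp [mul_add]) (by simp [mul_smul_comm])
  lact_mul := by simp [mul_assoc]
  ract_mul := by simp [mul_assoc]
  lact_ract := by simp [mul_assoc]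
  inner_ract := by simp [mul_assoc]
  star_inner := by simp
  inner_lact := by simp [mul_assoc]
  inner_self_pos a := ⟨a, rfl⟩
  inner_self_eq_zero a ha := (CStarRing.star_mul_self_eq_zero_iff a).1 ha
  complete u hu := by
    have h : ∀ z : A, √‖star z * z‖ = ‖z‖ := fun z => by
      rw [CStarRing.norm_star_mul_self, Real.sqrt_mul_self (norm_nonneg z)]
    simp only [LinearMap.mk₂'ₛₗ_apply, h] at hu ⊢
    have hu' : CauchySeq u := Metric.cauchySeq_iff.2 (by simpa only [dist_eq_norm] using hu)
    obtain ⟨x, hx⟩ := cauchySeq_tendsto_of_complete hu'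
    exact ⟨x, by simpa only [dist_eq_norm] using Metric.tendsto_atTop.1 hx⟩
  full := by
    refine Metric.dense_iff.2 fun a ε hε => ?_
    obtain ⟨e, -, he⟩ := exists_approx_unit a hε
    refine ⟨a * e, ?_, Submodule.subset_span ⟨star a, e, by simp⟩⟩
    rwa [Metric.mem_ball, dist_comm, dist_eq_norm]
  nondegenerate a ε hε := by
    have h : ∀ z : A, √‖star z * z‖ = ‖z‖ := fun z => by
      rw [CStarRing.norm_star_mul_self, Real.sqrt_mul_self (norm_nonneg z)]
    obtain ⟨e, -, he⟩ := exists_approx_unit a hε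
    exact ⟨a * e, Submodule.subset_span ⟨a, e, rfl⟩, by
      simpa only [LinearMap.mk₂'ₛₗ_apply, h] using he⟩

/-- The left unit isomorphism `A ⊗_A X ≅ X`, `a ⊗ x ↦ a · x`. -/
noncomputable def leftUnit (X : RightHilbertBimodule A B) : Iso ((identity A).tensor X) X :=
  Iso.ofDense (ofTensor (identity A) X)
    (show (identity A) ⊗[ℂ] X →ₗ[ℂ] X from TensorProduct.lift X.lact)
    (denseRange_ofTensor _ _)
    (by
      refine X.dense_lact.mono ?_
      have h : Submodule.span ℂ {z : X | ∃ a x, X.lact a x = z} ≤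
          LinearMap.range (show (identity A) ⊗[ℂ] X →ₗ[ℂ] X from TensorProduct.lift X.lact) := by
        refine Submodule.span_le.2 ?_
        rintro _ ⟨a, x, rfl⟩
        exact ⟨(show identity A from a) ⊗ₜ[ℂ] x, TensorProduct.lift.tmul _ _⟩
      exact h)
    (fun a t => LinearMap.rTensor X ((identity A).lact a) t)
    (fun a t => (lact_ofTensor (identity A) X a t).symm)
    (fun a t => by
      induction t with
      | zero => simp
      | tmul b x => exact X.lact_mul a b x
      | add s t hs ht => simp only [map_add, hs, ht])
    (inner_eq_of_tmul _ _ fun a x b y => by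
      rw [ofTensor_tmul, ofTensor_tmul, inner_tmul]
      have h : ∀ a b : A, X.inner (X.lact a x) (X.lact b y) = X.inner x (X.lact (star a * b) y) :=
        fun a b => by rw [X.inner_lact, X.lact_mul]
      exact (h a b).symm)

/-- The right unit isomorphism `X ⊗_B B ≅ X`, `x ⊗ b ↦ x · b`. -/
noncomputable def rightUnit (X : RightHilbertBimodule A B) : Iso (X.tensor (identity B)) X :=
  Iso.ofDense (ofTensor X (identity B))
    (show X ⊗[ℂ] (identity B) →ₗ[ℂ] X from TensorProduct.lift X.ract)
    (denseRange_ofTensor _ _)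
    (by
      refine Metric.denseRange_iff.2 fun x ε hε => ?_
      obtain ⟨e, he⟩ := exists_approx_ract X x hε
      refine ⟨x ⊗ₜ[ℂ] (show identity B from e), ?_⟩
      rw [dist_eq_norm]
      exact he)
    (fun a t => LinearMap.rTensor (identity B) (X.lact a) t)
    (fun a t => (lact_ofTensor X (identity B) a t).symm)
    (fun a t => by
      induction t with
      | zero => simp
      | tmul x b => exact (X.lact_ract a x b).symm
      | add s t hs ht => simp only [map_add, hs, ht])
    (inner_eq_of_tmul _ _ fun x a y b => by
      rw [ofTensor_tmul, ofTensor_tmul, inner_tmul]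
      have h : ∀ a b : B, X.inner (X.ract x a) (X.ract y b) = star a * (X.inner x y * b) :=
        fun a b => by rw [X.inner_ract, X.inner_ract_left, mul_assoc]
      exact (h a b).symm)

/-- The associativity isomorphism `(X ⊗_B Y) ⊗_C Z ≅ X ⊗_B (Y ⊗_C Z)`. -/
noncomputable def assoc (X : RightHilbertBimodule A B) (Y : RightHilbertBimodule B C)
    (Z : RightHilbertBimodule C D) : Iso ((X.tensor Y).tensor Z) (X.tensor (Y.tensor Z)) :=
  Iso.ofDense (T := (X ⊗[ℂ] Y) ⊗[ℂ] Z)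
    ((ofTensor (X.tensor Y) Z).comp (LinearMap.rTensor Z (ofTensor X Y)))
    ((ofTensor X (Y.tensor Z)).comp ((LinearMap.lTensor X (ofTensor Y Z)).comp
      (TensorProduct.assoc ℂ X Y Z).toLinearMap))
    (by
      refine denseRange_of_tmul _ fun w z ε hε => ?_
      obtain ⟨t, ht⟩ := Metric.denseRange_iff.1 (denseRange_ofTensor X Y) w (ε / (‖z‖ + 1))
        (by positivity)
      refine ⟨t ⊗ₜ z, ?_⟩
      rw [LinearMap.comp_apply, LinearMap.rTensor_tmul, ofTensor_tmul, tmul, ← map_sub,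
        ← TensorProduct.sub_tmul, ofTensor_tmul]
      rw [dist_eq_norm] at ht
      refine (norm_tmul_le _ _ _ _).trans_lt ?_
      rw [lt_div_iff₀ (by positivity)] at ht
      nlinarith [norm_nonneg (w - ofTensor X Y t), norm_nonneg z])
    (by
      refine denseRange_of_tmul _ fun x w ε hε => ?_
      obtain ⟨t, ht⟩ := Metric.denseRange_iff.1 (denseRange_ofTensor Y Z) w (ε / (‖x‖ + 1))
        (by positivity)
      refine ⟨(TensorProduct.assoc ℂ X Y Z).symm (x ⊗ₜ t), ?_⟩
      rw [LinearMap.comp_apply, LinearMap.comp_apply, LinearEquiv.coe_coe,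
        LinearEquiv.apply_symm_apply, LinearMap.lTensor_tmul, ofTensor_tmul, tmul, ← map_sub,
        ← TensorProduct.tmul_sub, ofTensor_tmul]
      rw [dist_eq_norm] at ht
      refine (norm_tmul_le _ _ _ _).trans_lt ?_
      rw [lt_div_iff₀ (by positivity)] at ht
      nlinarith [norm_nonneg (w - ofTensor Y Z t), norm_nonneg x])
    (fun a => LinearMap.rTensor Z (LinearMap.rTensor Y (X.lact a)))
    (fun a t => by
      induction t with
      | zero => simp
      | add s t hs ht => simp only [map_add, hs, ht]
      | tmul s z =>
        simp only [LinearMap.comp_apply, LinearMap.rTensor_tmul, ofTensor_tmul, lact_tmul,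
          lact_ofTensor])
    (fun a t => by
      induction t with
      | zero => simp
      | add s t hs ht => simp only [map_add, hs, ht]
      | tmul s z =>
        induction s with
        | zero => simp
        | add s t hs ht => simp only [TensorProduct.add_tmul, map_add, hs, ht]
        | tmul x y =>
          simp only [LinearMap.comp_apply, LinearMap.rTensor_tmul, LinearEquiv.coe_coe,
            TensorProduct.assoc_tmul, LinearMap.lTensor_tmul, ofTensor_tmul, lact_tmul])
    (inner_eq_of_tmul _ _ fun s z s' z' => by
      simp only [LinearMap.comp_apply, LinearMap.rTensor_tmul, ofTensor_tmul, inner_tmul]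
      induction s with
      | zero => simp
      | add s t hs ht =>
        simp only [TensorProduct.add_tmul, map_add, LinearMap.add_apply, hs, ht]
      | tmul x y =>
        induction s' with
        | zero => simp
        | add s t hs ht =>
          simp only [TensorProduct.add_tmul, map_add, LinearMap.add_apply, hs, ht]
        | tmul x' y' =>
          simp only [LinearEquiv.coe_coe, TensorProduct.assoc_tmul, LinearMap.lTensor_tmul,
            ofTensor_tmul, inner_tmul, lact_tmul])

end RightHilbertBimodule

/-! ### The category -/

/-- The objects of the category `𝒞`: C⋆-algebras, not necessarily unital. -/
structure CStarObj : Type (u + 1) where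
  /-- The underlying type. -/
  carrier : Type u
  [str : NonUnitalCStarAlgebra carrier]

namespace CStarObj

instance : CoeSort CStarObj.{u} (Type u) := ⟨carrier⟩

instance (A : CStarObj.{u}) : NonUnitalCStarAlgebra A := A.str

/-- Isomorphism of right-Hilbert bimodules as an equivalence relation. -/
def isoSetoid (A B : CStarObj.{u}) : Setoid (RightHilbertBimodule A B) where
  r X Y := Nonempty (X.Iso Y)
  iseqv := ⟨fun X => ⟨.refl X⟩, fun ⟨e⟩ => ⟨e.symm⟩, fun ⟨e⟩ ⟨f⟩ => ⟨e.trans f⟩⟩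

/-- The morphisms of `𝒞` from `A` to `B`: isomorphism classes of right-Hilbert `A`-`B`
bimodules. -/
def Hom (A B : CStarObj.{u}) : Type (u + 1) := Quotient (isoSetoid A B)

/-- The category `𝒞`: the composite of `[X] : A ⟶ B` and `[Y] : B ⟶ C` is `[X ⊗_B Y]`, and the
identity of `A` is `[_A A_A]`. -/
noncomputable instance : CategoryTheory.Category.{u + 1} CStarObj.{u} where
  Hom := Hom
  id A := Quotient.mk (isoSetoid A A) (RightHilbertBimodule.identity A)
  comp {A B C} f g := Quotient.map₂ (sa := isoSetoid A B) (sb := isoSetoid B C)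
    (sc := isoSetoid A C) RightHilbertBimodule.tensor
    (fun _ _ ⟨e⟩ _ _ ⟨e'⟩ => ⟨e.tensor e'⟩) f g
  id_comp {A B} f := by
    induction f using Quotient.inductionOn with
    | h X => exact Quotient.sound (s := isoSetoid A B) ⟨X.leftUnit⟩
  comp_id {A B} f := by
    induction f using Quotient.inductionOn with
    | h X => exact Quotient.sound (s := isoSetoid A B) ⟨X.rightUnit⟩
  assoc {A B C D} f g h := by
    induction f using Quotient.inductionOn with
    | h X =>
    induction g using Quotient.inductionOn with
    | h Y =>
    induction h using Quotient.inductionOn with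
    | h Z => exact Quotient.sound (s := isoSetoid A D) ⟨X.assoc Y Z⟩

end CStarObj

/-- The morphism `[X] : A ⟶ B` of `𝒞` given by a right-Hilbert `A`-`B` bimodule `X`. -/
def RightHilbertBimodule.toHom {A B : CStarObj.{u}} (X : RightHilbertBimodule A B) : A ⟶ B :=
  Quotient.mk (CStarObj.isoSetoid A B) X

end CStarMorita

/-!
Write `θ_{x,w}` for the rank-one operator `z ↦ x · ⟪w, z⟫_B` on `X`.

Suppose that `X` has an inverse `Y`, with `X ⊗_B Y ≅ A` and `Y ⊗_A X ≅ B`. Then `A` acts faithfully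
on `X` and `B` on `Y`. The operator `θ_{x,w} ⊗ 1` is the composite of the contraction
`z ⊗ y ↦ ⟪w, z⟫_B · y` with `y ↦ x ⊗ y`, so it is bounded by `‖x‖ ‖w‖`. Seen on `A` it is right
`A`-linear, that is, a multiplier, so that the operators `θ_{x,w} ∘ a = θ_{x, a⋆ · w}` are given by
elements of `A` (`exists_actsAsRankOne_lact`). As the left action is nondegenerate and the norm
bound makes the set of admissible `w` closed, every `θ_{x,w}` is the action of a unique
`_A⟪x, w⟫ ∈ A` (`exists_actsAsRankOne`). These elements span a dense subspace of `A`, because they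
act nondegenerately on `X` and hence on `X ⊗_B Y ≅ A` (`dense_span_actsAsRankOne`). The remaining
properties of an imprimitivity bimodule are identities between operators on `X`
(`isImprimitivityBimodule_of_actsAsRankOne`).

Conversely, an imprimitivity bimodule `X` has as inverse its dual `X̃` (`dual`), the conjugate vector
space with the actions and the two forms exchanged; the isomorphisms are `x ⊗ ỹ ↦ _A⟪x, y⟫`
(`tensorDualIso`) and `x̃ ⊗ y ↦ ⟪x, y⟫_B` (`dualTensorIso`).
-/

namespace CStarMorita

namespace RightHilbertBimodule

variable {A B C : Type u} [NonUnitalCStarAlgebra A] [NonUnitalCStarAlgebra B]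
  [NonUnitalCStarAlgebra C]

/-! ### Inner products and internal tensor products -/

theorem ext_inner_left (X : RightHilbertBimodule A B) {x y : X}
    (h : ∀ z, X.inner z x = X.inner z y) : x = y :=
  sub_eq_zero.1 (X.inner_self_eq_zero _ (by rw [map_sub, h, sub_self]))

theorem continuous_inner_right (X : RightHilbertBimodule A B) (x : X) :
    Continuous fun y : X => X.inner x y :=
  (X.innerL x).continuous

theorem continuous_inner_left (X : RightHilbertBimodule A B) (y : X) :
    Continuous fun x : X => X.inner x y := by
  have h : Continuous fun x : X => X.innerL x y := by fun_prop
  exact h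

theorem continuous_lact (X : RightHilbertBimodule A B) (a : A) :
    Continuous fun x : X => X.lact a x :=
  (X.lactL a).continuous

theorem lact_add_left (X : RightHilbertBimodule A B) (a a' : A) (x : X) :
    X.lact (a + a') x = X.lact a x + X.lact a' x := by
  rw [map_add, LinearMap.add_apply]

theorem lact_sub_left (X : RightHilbertBimodule A B) (a a' : A) (x : X) :
    X.lact (a - a') x = X.lact a x - X.lact a' x := by
  rw [map_sub, LinearMap.sub_apply]

theorem lact_smul_left (X : RightHilbertBimodule A B) (c : ℂ) (a : A) (x : X) :
    X.lact (c • a) x = c • X.lact a x := by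
  rw [map_smul, LinearMap.smul_apply]

theorem norm_identity (a : identity A) : ‖a‖ = ‖(show A from a)‖ := by
  have h : ‖a‖ = √‖star (show A from a) * (show A from a)‖ := rfl
  rw [h, CStarRing.norm_star_mul_self, Real.sqrt_mul_self (norm_nonneg _)]

/-- Density in `A` with its C⋆-norm is density in the bimodule `_A A_A`. -/
theorem denseRange_identity {T : Type u} [AddCommGroup T] [Module ℂ T]
    (g : T →ₗ[ℂ] identity A) {S : Set A} (hS : Dense (Submodule.span ℂ S : Set A))
    (h : ∀ s ∈ S, ∃ t, g t = s) : DenseRange g := by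
  let g' : T →ₗ[ℂ] A := g
  have h1 : Submodule.span ℂ S ≤ LinearMap.range g' := Submodule.span_le.2 h
  refine Metric.denseRange_iff.2 fun a ε hε => ?_
  obtain ⟨s, hs, hs'⟩ := Metric.dense_iff.1 hS (show A from a) ε hε
  obtain ⟨t, rfl⟩ := h1 hs'
  refine ⟨t, ?_⟩
  rw [dist_comm, dist_eq_norm, norm_identity]
  rw [Metric.mem_ball, dist_eq_norm] at hs
  exact hs

/-- The closed span of the products `x · ⟪w, z⟫_B` is all of `X`. -/
theorem dense_ract_inner (X : RightHilbertBimodule A B) :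
    Dense (Submodule.span ℂ {z : X | ∃ x w y, X.ract x (X.inner w y) = z} : Set X) := by
  set V := Submodule.span ℂ {z : X | ∃ x w y, X.ract x (X.inner w y) = z}
  have hW : IsClosed (V.topologicalClosure : Set X) := V.isClosed_topologicalClosure
  have h1 : ∀ (x : X) (b : B), X.ract x b ∈ V.topologicalClosure := by
    intro x b
    refine mem_of_dense_span X.full
      ((X.ract x).mkContinuous ‖x‖ (X.norm_ract_le x) : B →L[ℂ] X) _ hW ?_ b
    rintro _ ⟨w, y, rfl⟩
    exact V.le_topologicalClosure (Submodule.subset_span ⟨x, w, y, rfl⟩)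
  intro x
  change x ∈ (V.topologicalClosure : Set X)
  rw [← hW.closure_eq]
  refine Metric.mem_closure_iff.2 fun ε hε => ?_
  obtain ⟨b, hb⟩ := exists_approx_ract X x hε
  exact ⟨_, h1 x b, by rwa [dist_eq_norm]⟩

section Tensor

variable (X : RightHilbertBimodule A B) (Y : RightHilbertBimodule B C)

/-- A property of vectors of `X ⊗_B Y` that is closed, additive and holds for the elementary
tensors holds everywhere. -/
theorem tensor_induction_on {p : X.tensor Y → Prop} (ζ : X.tensor Y)
    (hp : IsClosed {ζ | p ζ}) (h0 : p 0) (ht : ∀ x y, p (tmul X Y x y))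
    (ha : ∀ s t, p s → p t → p (s + t)) : p ζ := by
  refine (denseRange_ofTensor X Y).induction_on (p := p) ζ hp fun t => ?_
  induction t with
  | zero => rwa [map_zero]
  | tmul x y => exact ht x y
  | add s t hs ht => rw [map_add]; exact ha _ _ hs ht

theorem tmul_sub_left (x x' : X) (y : Y) :
    tmul X Y (x - x') y = tmul X Y x y - tmul X Y x' y := by
  rw [tmul, TensorProduct.sub_tmul, map_sub]; rfl

/-- The internal tensor product is balanced over `B`. -/
theorem tmul_lact (x : X) (b : B) (y : Y) :
    tmul X Y x (Y.lact b y) = tmul X Y (X.ract x b) y := by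
  refine sub_eq_zero.1 ((X.tensor Y).inner_self_eq_zero _ ?_)
  simp only [map_sub, LinearMap.sub_apply, inner_tmul, X.inner_ract, X.inner_ract_left, Y.lact_mul,
    Y.inner_lact, sub_self]

/-- If `B` acts faithfully on `Y`, then `x ↦ x ⊗ y` separates the points of `X`. -/
theorem eq_zero_of_tmul_eq_zero (hY : ∀ b : B, (∀ y, Y.lact b y = 0) → b = 0) (x : X)
    (h : ∀ y, tmul X Y x y = 0) : x = 0 := by
  refine X.inner_self_eq_zero _ (hY _ fun y => ext_inner_left Y fun w => ?_)
  rw [← inner_tmul X Y x x w y, h y, map_zero, map_zero]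

/-- For `w ∈ X`, the map `x ⊗ y ↦ ⟪w, x⟫_B · y` on the algebraic tensor product. -/
noncomputable def contractAlg (w : X) : X ⊗[ℂ] Y →ₗ[ℂ] Y :=
  TensorProduct.lift (Y.lact ∘ₗ X.inner w)

theorem contractAlg_tmul (w x : X) (y : Y) :
    contractAlg X Y w (x ⊗ₜ[ℂ] y) = Y.lact (X.inner w x) y := rfl

theorem inner_tmul_ofTensor (w : X) (y : Y) (t : X ⊗[ℂ] Y) :
    (X.tensor Y).inner (tmul X Y w y) (ofTensor X Y t) = Y.inner y (contractAlg X Y w t) := by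
  induction t with
  | zero => simp
  | tmul x y' => rw [ofTensor_tmul, inner_tmul, contractAlg_tmul]
  | add s t hs ht => rw [map_add, map_add, map_add, map_add, hs, ht]

theorem norm_contractAlg_le (w : X) (t : X ⊗[ℂ] Y) :
    ‖contractAlg X Y w t‖ ≤ ‖w‖ * ‖ofTensor X Y t‖ := by
  set s := contractAlg X Y w t with hs
  have h : ‖s‖ ^ 2 ≤ ‖w‖ * ‖ofTensor X Y t‖ * ‖s‖ := by
    rw [Y.sq_norm]
    nth_rewrite 2 [hs]
    rw [← inner_tmul_ofTensor]
    calc _ ≤ ‖tmul X Y w s‖ * ‖ofTensor X Y t‖ := (X.tensor Y).norm_inner_le' _ _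
      _ ≤ ‖w‖ * ‖s‖ * ‖ofTensor X Y t‖ := by gcongr; exact norm_tmul_le X Y w s
      _ = _ := by ring
  rcases (norm_nonneg s).eq_or_lt with h0 | h0
  · rw [← h0]; positivity
  · rw [sq] at h
    exact le_of_mul_le_mul_right h h0

/-- For `w ∈ X`, the bounded operator `x ⊗ y ↦ ⟪w, x⟫_B · y` from `X ⊗_B Y` to `Y`. It is the
adjoint of `y ↦ w ⊗ y`. -/
noncomputable def contract (w : X) : X.tensor Y →L[ℂ] Y :=
  let T := PreHilbertBimodule.tensor X.toPreHilbertBimodule Y.toPreHilbertBimodule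
  ((show T →ₗ[ℂ] Y from contractAlg X Y w).mkContinuous ‖w‖ fun t => by
      have h : ‖ofTensor X Y t‖ = ‖t‖ := T.norm_toCompl t
      rw [← h]
      exact norm_contractAlg_le X Y w t : T →L[ℂ] Y).extend
    ((show T →ₗ[ℂ] X.tensor Y from ofTensor X Y).mkContinuous 1 fun t => by
      rw [one_mul]; exact (T.norm_toCompl t).le : T →L[ℂ] X.tensor Y)

theorem contract_ofTensor (w : X) (t : X ⊗[ℂ] Y) :
    contract X Y w (ofTensor X Y t) = contractAlg X Y w t := by
  let T := PreHilbertBimodule.tensor X.toPreHilbertBimodule Y.toPreHilbertBimodule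
  let i : T →L[ℂ] X.tensor Y := (show T →ₗ[ℂ] X.tensor Y from ofTensor X Y).mkContinuous 1
    fun t => by rw [one_mul]; exact (T.norm_toCompl t).le
  exact ContinuousLinearMap.extend_eq (e := i) _ (denseRange_ofTensor X Y)
    (AddMonoidHomClass.isometry_of_norm i T.norm_toCompl).isUniformInducing t

theorem contract_tmul (w x : X) (y : Y) :
    contract X Y w (tmul X Y x y) = Y.lact (X.inner w x) y :=
  contract_ofTensor X Y w _

theorem inner_tmul_left (w : X) (y : Y) (ζ : X.tensor Y) :
    (X.tensor Y).inner (tmul X Y w y) ζ = Y.inner y (contract X Y w ζ) := by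
  refine (denseRange_ofTensor X Y).induction_on
    (p := fun ζ => (X.tensor Y).inner (tmul X Y w y) ζ = Y.inner y (contract X Y w ζ)) ζ
    ?_ fun t => ?_
  · exact isClosed_eq (continuous_inner_right _ _)
      ((continuous_inner_right Y y).comp (contract X Y w).continuous)
  · rw [contract_ofTensor, inner_tmul_ofTensor]

theorem norm_contract_le (w : X) (ζ : X.tensor Y) : ‖contract X Y w ζ‖ ≤ ‖w‖ * ‖ζ‖ := by
  refine (denseRange_ofTensor X Y).induction_on
    (p := fun ζ => ‖contract X Y w ζ‖ ≤ ‖w‖ * ‖ζ‖) ζ ?_ fun t => ?_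
  · exact isClosed_le (contract X Y w).continuous.norm (continuous_norm.const_mul _)
  · rw [contract_ofTensor]; exact norm_contractAlg_le X Y w t

theorem contract_ract (w : X) (ζ : X.tensor Y) (c : C) :
    contract X Y w ((X.tensor Y).ract ζ c) = Y.ract (contract X Y w ζ) c :=
  ext_inner_left Y fun y => by
    rw [← inner_tmul_left, (X.tensor Y).inner_ract, inner_tmul_left, Y.inner_ract]

end Tensor

/-! ### Rank-one operators implemented by the left action -/

/-- The element `c` of `A` acts on `X` as the rank-one operator `z ↦ x · ⟪w, z⟫_B`. -/
def ActsAsRankOne (X : RightHilbertBimodule A B) (c : A) (x w : X) : Prop :=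
  ∀ z, X.lact c z = X.ract x (X.inner w z)

/-- An element of a faithfully acting C⋆-algebra that acts as a positive operator is positive: its
negative part acts as zero. -/
theorem isPos_of_inner_lact (X : RightHilbertBimodule A B)
    (hX : ∀ a : A, (∀ x, X.lact a x = 0) → a = 0) {g : A} (hg : IsSelfAdjoint g)
    (h : ∀ z, IsPos (X.inner z (X.lact g z))) : IsPos g := by
  let _ : PartialOrder B := CStarAlgebra.spectralOrder B
  have : StarOrderedRing B := CStarAlgebra.spectralOrderedRing B
  obtain ⟨N, S, hN, hS, h1, h0⟩ := PreHilbertBimodule.exists_negPart hg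
  have h2 : S * N = 0 := by
    refine hX _ fun z => X.inner_self_eq_zero _ (le_antisymm ?_ ?_)
    · have h3 : 0 ≤ X.inner (X.lact N z) (X.lact g (X.lact N z)) := isPos_iff_nonneg.1 (h _)
      rw [X.inner_lact, ← X.lact_mul, ← X.lact_mul, h1, map_neg, LinearMap.neg_apply,
        map_neg, X.lact_mul, neg_nonneg, ← X.inner_lact] at h3
      exact h3
    · exact isPos_iff_nonneg.1 (X.inner_self_pos _)
  refine h0 ((CStarRing.star_mul_self_eq_zero_iff N).1 ?_)
  rw [hN]
  nth_rewrite 1 [hS]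
  rw [mul_assoc, h2, mul_zero]

/-- If `A` acts faithfully on `X`, every rank-one operator is implemented by an element of `A` of
norm at most that of the operator, and these elements span a dense subspace of `A`, then `X` is an
imprimitivity bimodule. -/
theorem isImprimitivityBimodule_of_actsAsRankOne (X : RightHilbertBimodule A B)
    (hX : ∀ a : A, (∀ x, X.lact a x = 0) → a = 0)
    (hnorm : ∀ c x w, X.ActsAsRankOne c x w → ‖c‖ ≤ ‖x‖ * ‖w‖)
    (hex : ∀ x w, ∃ c, X.ActsAsRankOne c x w)
    (hfull : Dense (Submodule.span ℂ {c : A | ∃ x w, X.ActsAsRankOne c x w} : Set A)) :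
    X.IsImprimitivityBimodule := by
  choose c hc using hex
  have hfaith : ∀ a a' : A, (∀ z, X.lact a z = X.lact a' z) → a = a' := fun a a' h =>
    sub_eq_zero.1 (hX _ fun z => by rw [lact_sub_left, h, sub_self])
  let l : X →ₗ[ℂ] X →ₗ⋆[ℂ] A := LinearMap.mk₂'ₛₗ (RingHom.id ℂ) (starRingEnd ℂ) c
    (fun x x' w => hfaith _ _ fun z => by
      rw [lact_add_left, hc, hc, hc, map_add, LinearMap.add_apply])
    (fun k x w => hfaith _ _ fun z => by
      rw [RingHom.id_apply, lact_smul_left, hc, hc, map_smul, LinearMap.smul_apply])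
    (fun x w w' => hfaith _ _ fun z => by
      rw [lact_add_left, hc, hc, hc, map_add, LinearMap.add_apply, map_add])
    (fun k x w => hfaith _ _ fun z => by
      rw [lact_smul_left, hc, hc, map_smulₛₗ, LinearMap.smul_apply, map_smul])
  have hl : ∀ x w, X.ActsAsRankOne (l x w) x w := hc
  have hstar : ∀ x w, star (l x w) = l w x := fun x w => hfaith _ _ fun z =>
    ext_inner_left X fun y => by
      rw [← X.inner_lact, hl, hl, X.inner_ract_left, X.inner_ract, X.star_inner]
  have hnorm_eq : ∀ x, ‖l x x‖ = ‖X.inner x x‖ := by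
    intro x
    have h1 : ‖l x x‖ ≤ ‖X.inner x x‖ := by
      rw [← X.sq_norm, sq]; exact hnorm _ _ _ (hl x x)
    refine h1.antisymm ?_
    have h2 : ‖X.inner x x‖ * ‖X.inner x x‖ ≤ ‖l x x‖ * ‖X.inner x x‖ := by
      calc _ = ‖X.inner x (X.lact (l x x) x)‖ := by
            rw [← CStarRing.norm_star_mul_self, X.star_inner, hl, X.inner_ract]
        _ ≤ ‖x‖ * (‖l x x‖ * ‖x‖) :=
            (X.norm_inner_le' _ _).trans (by gcongr; exact X.norm_lact_le _ _)
        _ = _ := by rw [← X.sq_norm]; ring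
    rcases (norm_nonneg (X.inner x x)).eq_or_lt with h0 | h0
    · rw [← h0]; exact norm_nonneg _
    · exact le_of_mul_le_mul_right h2 h0
  refine ⟨l, ⟨fun a x y => hfaith _ _ fun z => ?_, hstar, fun x => ?_, fun x hx => ?_, ?_, ?_⟩,
    hl, fun x y b => hfaith _ _ fun z => ?_⟩
  · rw [X.lact_mul, hl, hl, X.lact_ract]
  · refine X.isPos_of_inner_lact hX (hstar x x) fun z => ?_
    rw [hl, X.inner_ract]
    exact ⟨X.inner x z, by rw [X.star_inner]⟩
  · refine X.inner_self_eq_zero _ ?_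
    rw [← norm_eq_zero, ← hnorm_eq, hx, norm_zero]
  · simp only [hnorm_eq]
    exact X.complete
  · refine hfull.mono (Submodule.span_mono ?_)
    rintro _ ⟨x, w, h⟩
    exact ⟨x, w, hfaith _ _ fun z => by rw [h, hl]⟩
  · rw [hl, hl, X.inner_ract_left, star_star, X.ract_mul]

/-! ### Invertible bimodules are imprimitivity bimodules -/

theorem norm_iso {X Y : RightHilbertBimodule A B} (e : Iso X Y) (x : X) :
    ‖e.toLinearEquiv x‖ = ‖x‖ := by
  rw [PreHilbertBimodule.norm_def, PreHilbertBimodule.norm_def, e.map_inner]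

/-- A bimodule isomorphism onto `_A A_A`, as an isometry onto `A` with its C⋆-norm. -/
noncomputable def Iso.toAlgebra {Z : RightHilbertBimodule A A} (e : Iso Z (identity A)) :
    Z ≃ₗᵢ[ℂ] A where
  toLinearEquiv := (show Z ≃ₗ[ℂ] A from e.toLinearEquiv)
  norm_map' z := (norm_identity _).symm.trans (norm_iso e z)

theorem Iso.toAlgebra_lact {Z : RightHilbertBimodule A A} (e : Iso Z (identity A)) (a : A) (z : Z) :
    e.toAlgebra (Z.lact a z) = a * e.toAlgebra z := e.map_lact a z

theorem Iso.toAlgebra_ract {Z : RightHilbertBimodule A A} (e : Iso Z (identity A)) (z : Z) (a : A) :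
    e.toAlgebra (Z.ract z a) = e.toAlgebra z * a := e.map_ract z a

section Inverse

variable {X : RightHilbertBimodule A B} {Y : RightHilbertBimodule B A}

/-- If `X ⊗_B Y ≅ A`, then `A` acts faithfully on `X`. -/
theorem eq_zero_of_lact_eq_zero (e : Iso (X.tensor Y) (identity A)) (a : A)
    (h : ∀ x, X.lact a x = 0) : a = 0 := by
  have h1 : ∀ ζ, (X.tensor Y).lact a ζ = 0 := fun ζ =>
    tensor_induction_on X Y (p := fun ζ => (X.tensor Y).lact a ζ = 0) ζ
      (isClosed_eq (continuous_lact _ a) continuous_const) (map_zero _)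
      (fun x y => by rw [lact_tmul, h, tmul, TensorProduct.zero_tmul, map_zero])
      (fun s t hs ht => by rw [map_add, hs, ht, add_zero])
  have h2 := e.toAlgebra_lact a (e.toAlgebra.symm (star a))
  rw [h1, map_zero, LinearIsometryEquiv.apply_symm_apply] at h2
  exact (CStarRing.mul_star_self_eq_zero_iff a).1 h2.symm

/-- An element acting on `X` as the rank-one operator of `x` and `w` acts on `X ⊗_B Y` as the
composite of the contraction by `w` with `y ↦ x ⊗ y`. -/
theorem ActsAsRankOne.lact_tensor {c : A} {x w : X} (h : X.ActsAsRankOne c x w)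
    (ζ : X.tensor Y) : (X.tensor Y).lact c ζ = tmul X Y x (contract X Y w ζ) := by
  refine tensor_induction_on X Y
    (p := fun ζ => (X.tensor Y).lact c ζ = tmul X Y x (contract X Y w ζ)) ζ
    (isClosed_eq (continuous_lact _ c) ?_) ?_ (fun z y => ?_) fun s t hs ht => ?_
  · let R : Y →ₗ[ℂ] X.tensor Y := ofTensor X Y ∘ₗ TensorProduct.mk ℂ X Y x
    exact (R.mkContinuous ‖x‖ (norm_tmul_le X Y x)).continuous.comp (contract X Y w).continuous
  · rw [map_zero, map_zero, tmul, TensorProduct.tmul_zero, map_zero]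
  · rw [lact_tmul, h, contract_tmul, tmul_lact]
  · rw [map_add, hs, ht, map_add, tmul, tmul, tmul, TensorProduct.tmul_add, map_add]

theorem ActsAsRankOne.norm_le (e : Iso (X.tensor Y) (identity A)) {c : A} {x w : X}
    (h : X.ActsAsRankOne c x w) : ‖c‖ ≤ ‖x‖ * ‖w‖ := by
  have h2 : ‖c * star c‖ ≤ ‖x‖ * ‖w‖ * ‖c‖ := by
    calc ‖c * star c‖ = ‖tmul X Y x (contract X Y w (e.toAlgebra.symm (star c)))‖ := by
          rw [← h.lact_tensor, ← e.toAlgebra.norm_map, e.toAlgebra_lact,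
            LinearIsometryEquiv.apply_symm_apply]
      _ ≤ ‖x‖ * (‖w‖ * ‖e.toAlgebra.symm (star c)‖) :=
          (norm_tmul_le _ _ _ _).trans (by gcongr; exact norm_contract_le _ _ _ _)
      _ = ‖x‖ * ‖w‖ * ‖c‖ := by rw [LinearIsometryEquiv.norm_map, norm_star, mul_assoc]
  rw [CStarRing.norm_self_mul_star] at h2
  rcases (norm_nonneg c).eq_or_lt with h0 | h0
  · rw [← h0]; positivity
  · exact le_of_mul_le_mul_right h2 h0

/-- Let `X ⊗_B Y ≅ A`, and let `θ` be the rank-one operator of `x` and `w`. Carried over to `A`,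
the operator `θ ⊗ 1` is right `A`-linear, so its composite with left multiplication by `a⋆` is left
multiplication by `c = (θ ⊗ 1) a⋆`. As `B` acts faithfully on `Y`, it follows that `θ ∘ a⋆ = c` on
`X`, and `θ ∘ a⋆` is the rank-one operator of `x` and `a · w`. -/
theorem exists_actsAsRankOne_lact (e : Iso (X.tensor Y) (identity A))
    (hY : ∀ b : B, (∀ y, Y.lact b y = 0) → b = 0) (x w : X) (a : A) :
    ∃ c, X.ActsAsRankOne c x (X.lact a w) := by
  let ξ : X.tensor Y := e.toAlgebra.symm (star a)
  let c : A := e.toAlgebra (tmul X Y x (contract X Y w ξ))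
  have h1 : ∀ ζ, (X.tensor Y).lact (star a) ζ = (X.tensor Y).ract ξ (e.toAlgebra ζ) := fun ζ =>
    e.toAlgebra.injective (by
      rw [e.toAlgebra_lact, e.toAlgebra_ract, LinearIsometryEquiv.apply_symm_apply])
  have h2 : ∀ ζ, (X.tensor Y).lact c ζ =
      tmul X Y x (contract X Y w ((X.tensor Y).lact (star a) ζ)) := fun ζ =>
    e.toAlgebra.injective (by
      rw [h1, contract_ract, ← ract_tmul, e.toAlgebra_lact, e.toAlgebra_ract])
  refine ⟨c, fun z => sub_eq_zero.1 (eq_zero_of_tmul_eq_zero X Y hY _ fun y => ?_)⟩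
  rw [tmul_sub_left, ← lact_tmul, h2, lact_tmul, contract_tmul, tmul_lact, X.inner_lact, sub_self]

/-- The vectors `w` for which the rank-one operator of `x` and `w` is implemented by `A`. -/
def implementedSubmodule (X : RightHilbertBimodule A B) (x : X) : Submodule ℂ X where
  carrier := {w | ∃ c, X.ActsAsRankOne c x w}
  zero_mem' := ⟨0, fun z => by simp⟩
  add_mem' := by
    rintro w w' ⟨c, hc⟩ ⟨c', hc'⟩
    exact ⟨c + c', fun z => by
      rw [lact_add_left, hc, hc', map_add, LinearMap.add_apply, map_add]⟩
  smul_mem' := by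
    rintro k w ⟨c, hc⟩
    exact ⟨(starRingEnd ℂ) k • c, fun z => by
      rw [lact_smul_left, hc, map_smulₛₗ, LinearMap.smul_apply, map_smul]⟩

theorem ActsAsRankOne.sub {c c' : A} {x w w' : X} (h : X.ActsAsRankOne c x w)
    (h' : X.ActsAsRankOne c' x w') : X.ActsAsRankOne (c - c') x (w - w') := fun z => by
  rw [lact_sub_left, h, h', map_sub, LinearMap.sub_apply, map_sub]

theorem isClosed_implementedSubmodule (X : RightHilbertBimodule A B)
    (hnorm : ∀ (c : A) (x w : X), X.ActsAsRankOne c x w → ‖c‖ ≤ ‖x‖ * ‖w‖) (x : X) :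
    IsClosed (implementedSubmodule X x : Set X) := by
  refine isClosed_of_closure_subset fun w hw => ?_
  obtain ⟨u, hu, hlim⟩ := mem_closure_iff_seq_limit.1 hw
  choose c hc using hu
  have hcauchy : CauchySeq c := by
    refine Metric.cauchySeq_iff.2 fun ε hε => ?_
    obtain ⟨N, hN⟩ := Metric.cauchySeq_iff.1 hlim.cauchySeq (ε / (‖x‖ + 1)) (by positivity)
    refine ⟨N, fun m hm n hn => ?_⟩
    have h := hN m hm n hn
    rw [dist_eq_norm, lt_div_iff₀ (by positivity)] at h
    rw [dist_eq_norm]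
    have h1 := hnorm _ _ _ ((hc m).sub (hc n))
    nlinarith [norm_nonneg (u m - u n), norm_nonneg x]
  obtain ⟨c₀, hc₀⟩ := cauchySeq_tendsto_of_complete hcauchy
  refine ⟨c₀, fun z => ?_⟩
  have h1 : Continuous fun a : A => X.lact a z :=
    ((X.lact.flip z).mkContinuous ‖z‖ fun a => by
      rw [mul_comm]; exact X.norm_lact_le a z : A →L[ℂ] X).continuous
  have h2 : Continuous fun b : B => X.ract x b :=
    ((X.ract x).mkContinuous ‖x‖ (X.norm_ract_le x) : B →L[ℂ] X).continuous
  refine tendsto_nhds_unique ((h1.tendsto c₀).comp hc₀) ?_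
  refine (((h2.comp (continuous_inner_left X z)).tendsto w).comp hlim).congr fun n => ?_
  exact (hc n z).symm

theorem exists_actsAsRankOne (e : Iso (X.tensor Y) (identity A))
    (hY : ∀ b : B, (∀ y, Y.lact b y = 0) → b = 0) (x w : X) :
    ∃ c, X.ActsAsRankOne c x w := by
  refine mem_of_dense_span X.dense_lact (ContinuousLinearMap.id ℂ X) (implementedSubmodule X x)
    (isClosed_implementedSubmodule X (fun _ _ _ h => h.norm_le e) x) ?_ w
  rintro _ ⟨a, w', rfl⟩
  exact exists_actsAsRankOne_lact e hY x w' a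

/-- The elements of `A` that implement rank-one operators act nondegenerately on `X`, hence on
`X ⊗_B Y ≅ A`, and they span a right ideal, so they span a dense subspace of `A`. -/
theorem dense_span_actsAsRankOne (e : Iso (X.tensor Y) (identity A))
    (hY : ∀ b : B, (∀ y, Y.lact b y = 0) → b = 0) :
    Dense (Submodule.span ℂ {c : A | ∃ x w, X.ActsAsRankOne c x w} : Set A) := by
  set V := Submodule.span ℂ {c : A | ∃ x w, X.ActsAsRankOne c x w}
  have hW : IsClosed (V.topologicalClosure : Set A) := V.isClosed_topologicalClosure
  have hmul : ∀ c x w, X.ActsAsRankOne c x w → ∀ a : A, c * a ∈ V := fun c x w h a =>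
    Submodule.subset_span ⟨x, X.lact (star a) w, fun z => by
      rw [X.lact_mul, h, X.inner_lact, star_star]⟩
  have h1 : ∀ x y, e.toAlgebra (tmul X Y x y) ∈ V.topologicalClosure := by
    intro x y
    let L : X →ₗ[ℂ] X.tensor Y := ofTensor X Y ∘ₗ (TensorProduct.mk ℂ X Y).flip y
    let L' : X →L[ℂ] X.tensor Y := L.mkContinuous ‖y‖ fun x => by
      rw [mul_comm]; exact norm_tmul_le X Y x y
    refine mem_of_dense_span X.dense_ract_inner
      ((e.toAlgebra.toContinuousLinearEquiv : X.tensor Y →L[ℂ] A) ∘L L') _ hW ?_ x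
    rintro _ ⟨x, w, z, rfl⟩
    obtain ⟨c, hc⟩ := exists_actsAsRankOne e hY x w
    refine V.le_topologicalClosure ?_
    change e.toAlgebra (tmul X Y (X.ract x (X.inner w z)) y) ∈ V
    rw [← hc, ← lact_tmul, e.toAlgebra_lact]
    exact hmul c x w hc _
  intro a
  have h2 : e.toAlgebra (e.toAlgebra.symm a) ∈ V.topologicalClosure :=
    tensor_induction_on X Y (p := fun ζ => e.toAlgebra ζ ∈ V.topologicalClosure) _
      (hW.preimage e.toAlgebra.continuous) (by rw [map_zero]; exact Submodule.zero_mem _) h1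
      fun s t hs ht => by rw [map_add]; exact Submodule.add_mem _ hs ht
  rwa [LinearIsometryEquiv.apply_symm_apply] at h2

theorem isImprimitivityBimodule_of_iso (e : Iso (X.tensor Y) (identity A))
    (f : Iso (Y.tensor X) (identity B)) : X.IsImprimitivityBimodule :=
  X.isImprimitivityBimodule_of_actsAsRankOne (eq_zero_of_lact_eq_zero e)
    (fun _ _ _ h => h.norm_le e) (exists_actsAsRankOne e (eq_zero_of_lact_eq_zero f))
    (dense_span_actsAsRankOne e (eq_zero_of_lact_eq_zero f))

end Inverse

/-! ### The dual of an imprimitivity bimodule -/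

/-- The conjugate of a complex vector space: the same additive group, on which a scalar `c` acts as
its complex conjugate did. -/
def Conj (V : Type u) : Type u := V

namespace Conj

variable {V : Type u} [AddCommGroup V] [Module ℂ V]

instance : AddCommGroup (Conj V) := inferInstanceAs (AddCommGroup V)

noncomputable instance : Module ℂ (Conj V) := Module.compHom V (starRingEnd ℂ)

/-- The identity map, as a conjugate-linear map to the conjugate space. -/
def mk : V →ₗ⋆[ℂ] Conj V where
  toFun v := v
  map_add' _ _ := rfl
  map_smul' c v := by
    have h : (starRingEnd ℂ c • (show Conj V from v)) =
      (show Conj V from starRingEnd ℂ (starRingEnd ℂ c) • v) := rfl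
    rw [h, Complex.conj_conj]

/-- The identity map, as a conjugate-linear map from the conjugate space. -/
def out : Conj V →ₗ⋆[ℂ] V where
  toFun v := v
  map_add' _ _ := rfl
  map_smul' _ _ := rfl

@[simp] theorem out_mk (v : V) : out (mk v) = v := rfl

end Conj

section Dual

variable (X : RightHilbertBimodule A B) (l : X →ₗ[ℂ] X →ₗ⋆[ℂ] A) (hl : X.IsLeftHilbert l)
  (hr : ∀ x y b, l (X.ract x b) y = l x (X.ract y (star b)))

/-- The dual of a bimodule `X` with an `A`-valued form `l`: the conjugate vector space, with
`b · x̃ = (x · b⋆)~`, `x̃ · a = (a⋆ · x)~` and `⟪x̃, ỹ⟫_A = l x y`, as a right-pre-Hilbert `B`-`A`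
bimodule. -/
noncomputable def preDual : PreHilbertBimodule B A where
  carrier := Conj X
  lact := LinearMap.mk₂ ℂ (fun b x => Conj.mk (X.ract x.out (star b)))
    (by simp) (by simp) (by simp) (by simp)
  ract := LinearMap.mk₂ ℂ (fun x a => Conj.mk (X.lact (star a) x.out))
    (by simp) (by simp) (by simp) (by simp)
  inner := LinearMap.mk₂'ₛₗ (starRingEnd ℂ) (RingHom.id ℂ) (fun x y => l x.out y.out)
    (by simp) (by simp) (by simp) (by simp)
  lact_mul b b' x := by simp [X.ract_mul]
  ract_mul x a a' := by simp [X.lact_mul]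
  lact_ract b x a := by simp [X.lact_ract]
  inner_ract x y a := by
    simp only [LinearMap.mk₂'ₛₗ_apply, LinearMap.mk₂_apply, Conj.out_mk]
    rw [← hl.star_form, hl.lact_left, star_mul, star_star, hl.star_form]
  star_inner x y := hl.star_form _ _
  inner_lact b x y := by simp [hr]
  inner_self_pos x := hl.self_pos _

/-- The two norms of `X` compare because `(l x x)² = l (x · ⟪x, x⟫_B) x`, and right multiplication
by `b`, being the left action of `b⋆` on the dual, is bounded by `‖b‖` in the seminorm of `l`. -/
theorem norm_form_self_le (X : RightHilbertBimodule A B) (l : X →ₗ[ℂ] X →ₗ⋆[ℂ] A)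
    (hl : X.IsLeftHilbert l)
    (hr : ∀ x y b, l (X.ract x b) y = l x (X.ract y (star b)))
    (hlr : ∀ x y z, X.lact (l x y) z = X.ract x (X.inner y z)) (x : X) :
    ‖l x x‖ ≤ ‖X.inner x x‖ := by
  let P := preDual X l hl hr
  let x' : P := Conj.mk x
  have h1 : P.inner (P.lact (X.inner x x) x') x' = l x x * l x x := by
    rw [← hl.lact_left, hlr]
    change l (X.ract x (star (X.inner x x))) x = _
    rw [X.star_inner]
  have hx' : ‖x'‖ ^ 2 = ‖l x x‖ := P.sq_norm x'
  have h2 : ‖l x x‖ * ‖l x x‖ ≤ ‖X.inner x x‖ * ‖l x x‖ := by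
    calc _ = ‖P.inner (P.lact (X.inner x x) x') x'‖ := by
          rw [h1, ← CStarRing.norm_star_mul_self, hl.star_form]
      _ ≤ ‖X.inner x x‖ * ‖x'‖ * ‖x'‖ :=
          (P.norm_inner_le' _ _).trans (by gcongr; exact P.norm_lact_le _ _)
      _ = _ := by rw [← hx']; ring
  rcases (norm_nonneg (l x x)).eq_or_lt with h0 | h0
  · rw [← h0]; exact norm_nonneg _
  · exact le_of_mul_le_mul_right h2 h0

/-- The dual `X̃` of an imprimitivity bimodule `X`, a right-Hilbert `B`-`A` bimodule. -/
noncomputable def dual (hlr : ∀ x y z, X.lact (l x y) z = X.ract x (X.inner y z)) :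
    RightHilbertBimodule B A where
  toPreHilbertBimodule := preDual X l hl hr
  inner_self_eq_zero := hl.self_eq_zero
  complete := hl.complete
  full := hl.full
  nondegenerate x ε hε := by
    obtain ⟨b, hb⟩ := exists_approx_ract X (Conj.out x) hε
    refine ⟨Conj.mk (X.ract (Conj.out x) b), Submodule.subset_span ⟨star b, x, ?_⟩, ?_⟩
    · change Conj.mk (X.ract (Conj.out x) (star (star b))) = _
      rw [star_star]; rfl
    · refine lt_of_le_of_lt (Real.sqrt_le_sqrt ?_) hb
      exact norm_form_self_le X l hl hr hlr
        ((show X from Conj.out x) - X.ract (Conj.out x) b)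

variable (hlr : ∀ x y z, X.lact (l x y) z = X.ract x (X.inner y z))

/-- `X ⊗_B X̃ ≅ A`, `x ⊗ ỹ ↦ l x y`. -/
noncomputable def tensorDualIso : Iso (X.tensor (X.dual l hl hr hlr)) (identity A) :=
  let g₀ : X →ₗ[ℂ] Conj X →ₗ[ℂ] A :=
    LinearMap.mk₂ ℂ (fun x y => l x y.out) (by simp) (by simp) (by simp) (by simp)
  let g : X ⊗[ℂ] (X.dual l hl hr hlr) →ₗ[ℂ] identity A := TensorProduct.lift g₀
  Iso.ofDense (ofTensor X (X.dual l hl hr hlr)) g (denseRange_ofTensor _ _)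
    (denseRange_identity g hl.full (by
      rintro _ ⟨x, y, rfl⟩
      exact ⟨x ⊗ₜ[ℂ] (show X.dual l hl hr hlr from Conj.mk y), rfl⟩))
    (fun a t => LinearMap.rTensor (X.dual l hl hr hlr) (X.lact a) t)
    (fun a t => (lact_ofTensor X (X.dual l hl hr hlr) a t).symm)
    (fun a t => by
      induction t with
      | zero => simp
      | tmul x y => exact hl.lact_left a x _
      | add s t hs ht => simp only [map_add, hs, ht])
    (inner_eq_of_tmul _ _ fun x y z w => by
      rw [ofTensor_tmul, ofTensor_tmul, inner_tmul]
      change l (Conj.out y) (X.ract (Conj.out w) (star (X.inner x z))) =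
        star (l x (Conj.out y)) * l z (Conj.out w)
      rw [hl.star_form, ← hl.lact_left, hlr, hr])

/-- `X̃ ⊗_A X ≅ B`, `x̃ ⊗ y ↦ ⟪x, y⟫_B`. -/
noncomputable def dualTensorIso : Iso ((X.dual l hl hr hlr).tensor X) (identity B) :=
  let g₀ : Conj X →ₗ[ℂ] X →ₗ[ℂ] B :=
    LinearMap.mk₂ ℂ (fun x y => X.inner x.out y) (by simp) (by simp) (by simp) (by simp)
  let g : (X.dual l hl hr hlr) ⊗[ℂ] X →ₗ[ℂ] identity B := TensorProduct.lift g₀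
  Iso.ofDense (ofTensor (X.dual l hl hr hlr) X) g (denseRange_ofTensor _ _)
    (denseRange_identity g X.full (by
      rintro _ ⟨x, y, rfl⟩
      exact ⟨(show X.dual l hl hr hlr from Conj.mk x) ⊗ₜ[ℂ] y, rfl⟩))
    (fun b t => LinearMap.rTensor X ((X.dual l hl hr hlr).lact b) t)
    (fun b t => (lact_ofTensor (X.dual l hl hr hlr) X b t).symm)
    (fun b t => by
      induction t with
      | zero => simp
      | tmul x y =>
        change X.inner (X.ract (Conj.out x) (star b)) y = b * X.inner (Conj.out x) y
        rw [X.inner_ract_left, star_star]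
      | add s t hs ht => simp only [map_add, hs, ht])
    (inner_eq_of_tmul _ _ fun x y z w => by
      rw [ofTensor_tmul, ofTensor_tmul, inner_tmul]
      change X.inner y (X.lact (l (Conj.out x) (Conj.out z)) w) =
        star (X.inner (Conj.out x) y) * X.inner (Conj.out z) w
      rw [hlr, X.inner_ract, X.star_inner])

end Dual

end RightHilbertBimodule

end CStarMorita

theorem proposition2p5 (A B : CStarMorita.CStarObj.{u})
    (X : CStarMorita.RightHilbertBimodule A B) :
    CategoryTheory.IsIso (X.toHom : A ⟶ B) ↔ X.IsImprimitivityBimodule := by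
  open CStarMorita in
  constructor
  · rintro ⟨y, hXY, hYX⟩
    induction y using Quotient.inductionOn with
    | h Y =>
      obtain ⟨e⟩ : Nonempty ((X.tensor Y).Iso (RightHilbertBimodule.identity A)) :=
        Quotient.exact (s := CStarObj.isoSetoid A A) hXY
      obtain ⟨f⟩ : Nonempty ((Y.tensor X).Iso (RightHilbertBimodule.identity B)) :=
        Quotient.exact (s := CStarObj.isoSetoid B B) hYX
      exact RightHilbertBimodule.isImprimitivityBimodule_of_iso e f
  · rintro ⟨l, hl, hlr, hr⟩
    exact ⟨(X.dual l hl hr hlr).toHom,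
      Quotient.sound (s := CStarObj.isoSetoid A A) ⟨X.tensorDualIso l hl hr hlr⟩,
      Quotient.sound (s := CStarObj.isoSetoid B B) ⟨X.dualTensorIso l hl hr hlr⟩⟩
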